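/- For an integer $N\ge 1$ and $p\in[0,1]$ let $G(N,p)$ be the binomial random graph on $N$ labelled vertices (each pair of vertices is an edge independently with probability $p$), let $P_{k}$ be the path on $k$ vertices, and for graphs $G,F$ let $\mathrm{ex}(G,F)$ be the maximum number of edges in a subgraph of $G$ that contains no copy of $F$. All logarithms are natural. Let $N=N(n)$ be integers with $3n\le N\le n e^{2n}$ for all sufficiently large $n$, and let $p=p(n)\in[0,1]$. (i) If $p\ge \frac{\log(N/n)}{6n}$ for all sufficiently large $n$, then $$\Pr\Big[\tfrac14\,pnN\le \mathrm{ex}(G(N,p),P_{n+1})\le 18\,pnN\Big]\to 1\quad\text{as } n\to\infty.$$ (ii) Let $\omega=\omega(n)=\frac{\log(N/n)}{np}$. If $\frac1N\le p\le \frac{\log(N/n)}{6n}$ for all sufficiently large $n$, then $$\Pr\Big[\tfrac1{75}\,\tfrac{\omega}{\log\omega}\,pnN\le \mathrm{ex}(G(N,p),P_{n+1})\le 8\,\tfrac{\omega}{\log\omega}\,pnN\Big]\to 1\quad\text{as } n\to\infty.$$ -/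

import Mathlib

open Filter Topology

namespace SimpleGraph

open scoped Classical in
/-- The relative extremal number `ex(G, F)` of a finite graph `G`: the maximum number of edges of
an `F`-free subgraph of `G`. The subgraphs may be taken spanning: adding isolated vertices changes
neither the number of edges nor `F`-freeness, for `F` connected with at least two vertices. -/
noncomputable def exIn {V W : Type*} [Fintype V] (G : SimpleGraph V) (F : SimpleGraph W) : ℕ :=
  Finset.sup {H : SimpleGraph V | H ≤ G ∧ F.Free H} fun H ↦ H.edgeFinset.card

/-- The probability that the binomial random graph `G(N, p)` satisfies
`a ≤ ex(G(N, p), P_k) ≤ b`, where `P_k` is the path on `k` vertices. -/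
noncomputable def probExPath (N : ℕ) (p : unitInterval) (k : ℕ) (a b : ℝ) : ℝ :=
  (binomialRandom (Fin N) p).real
    {G | a ≤ (G.exIn (pathGraph k) : ℝ) ∧ (G.exIn (pathGraph k) : ℝ) ≤ b}

end SimpleGraph

/-! Upper bound. Run a depth-first search in a subgraph `H` without a path on n+1 vertices. The
stack is a path of `H`, so it never holds more than n vertices, and finished vertices have no
undiscovered neighbours. Cut the order of discovery into N/n + 1 blocks of at most n vertices. An
edge meeting a block and no later block lies inside the block together with the stack at its start,
a set of at most 2n vertices (`exIn_pathGraph_le`). It remains to bound the edges of the random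
graph inside every set of 2n vertices, by a union bound over these sets (`measureReal_lt_exIn_le`).
When N < 8n the total number of edges is used instead.

Lower bound. Write L = log(N/n). In the dense range, intersect the graph with disjoint cliques on n
vertices and apply Chebyshev. In the sparse range the target is of order (L / log ω) N, because ωnp
= L. If L ≤ 10 log ω this is linear in N and a star forest suffices. Otherwise reserve about N/(2n)
cells, each split into d ≈ L / (8 log ω) groups of k ≈ n/(2d) vertices. An outer vertex is good for
a cell if it has a neighbour in every group, which has probability at least ω^(-d), a small negative
power of N/n. Since there are about N/(2n) cells, large sets of cells and of outer vertices always
contain a good pair, so a maximal assignment of at most n/2 good vertices per cell fills half of the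
cells (`mul_le_two_mul_exIn`). Each piece has at most n vertices, and each assigned vertex
contributes d edges. -/

namespace SimpleGraph

open MeasureTheory ProbabilityTheory unitInterval

/-! ### Independence of events on disjoint sets of pairs, and Chebyshev's inequality -/

variable {V : Type*}

/-- The event `E` depends only on which of the pairs in `S` are edges. -/
def DeterminedBy (E : Set (SimpleGraph V)) (S : Set (Sym2 V)) : Prop :=
  ∀ G G' : SimpleGraph V, (∀ e ∈ S, e ∈ G.edgeSet ↔ e ∈ G'.edgeSet) → G ∈ E → G' ∈ E

lemma DeterminedBy.compl {E : Set (SimpleGraph V)} {S : Set (Sym2 V)} (h : DeterminedBy E S) :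
    DeterminedBy Eᶜ S :=
  fun G G' hG hE hE' => hE (h G' G (fun e he => (hG e he).symm) hE')

lemma DeterminedBy.iInter {ι : Type*} {B : Set ι} {E : ι → Set (SimpleGraph V)}
    {S : ι → Set (Sym2 V)} (h : ∀ b ∈ B, DeterminedBy (E b) (S b)) :
    DeterminedBy (⋂ b ∈ B, E b) (⋃ b ∈ B, S b) := by
  intro G G' hG hE
  simp only [Set.mem_iInter] at hE ⊢
  exact fun b hb => h b hb G G' (fun e he => hG e (Set.mem_biUnion hb he)) (hE b hb)

lemma determinedBy_mem (e : Sym2 V) : DeterminedBy {G | e ∈ G.edgeSet} {e} :=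
  fun _ _ h => (h e rfl).1

lemma DeterminedBy.eq_mem {E : Set (SimpleGraph V)} {S : Set (Sym2 V)} (h : DeterminedBy E S)
    (G G' : SimpleGraph V) (hG : ∀ e ∈ S, e ∈ G.edgeSet ↔ e ∈ G'.edgeSet) :
    (G ∈ E) = (G' ∈ E) :=
  propext ⟨h G G' hG, h G' G fun e he => (hG e he).symm⟩

lemma determinedBy_exists_mem (T : Finset (Sym2 V)) :
    DeterminedBy {G : SimpleGraph V | ∃ e ∈ T, e ∈ G.edgeSet} T := by
  rintro G G' h ⟨e, he, heG⟩
  exact ⟨e, he, (h e he).1 heG⟩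

lemma measurable_fromEdgeSet_ofPred :
    Measurable fun ω : Sym2 V → Prop ↦ fromEdgeSet {e | ω e} :=
  measurable_fromEdgeSet.comp MeasurableEquiv.setOfPred.measurable

section Finite

variable [Finite V] (p : I)

/-- A graph is determined by its edge set, so singletons are measurable, and there are finitely many
graphs. Every event below is therefore measurable. -/
instance : DiscreteMeasurableSpace (SimpleGraph V) := by
  have : MeasurableSingletonClass (SimpleGraph V) :=
    ⟨fun G => by
      have : ({G} : Set (SimpleGraph V)) = edgeSet ⁻¹' {G.edgeSet} := by
        ext H; simp
      rw [this]
      exact measurable_edgeSet (measurableSet_singleton _)⟩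
  infer_instance

/-- The law of independent `p`-Bernoulli indicators of the pairs of distinct vertices. -/
noncomputable def pairMeasure (V : Type*) (p : I) : Measure (Sym2 V → Prop) :=
  Measure.infinitePi fun e : Sym2 V ↦
    toNNReal p • Measure.dirac (e ∈ (Sym2.diagSetᶜ : Set (Sym2 V))) +
      toNNReal (σ p) • Measure.dirac False

lemma binomialRandom_eq_map_pairMeasure : binomialRandom V p =
    (pairMeasure V p).map (fun ω : Sym2 V → Prop ↦ fromEdgeSet {e | ω e}) := by
  rw [binomialRandom_eq_map, setBernoulli_eq_map]
  exact Measure.map_map measurable_fromEdgeSet MeasurableEquiv.setOfPred.measurable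

lemma iIndepFun_mem_edgeSet :
    iIndepFun (fun (e : Sym2 V) (G : SimpleGraph V) => e ∈ G.edgeSet) (binomialRandom V p) := by
  have hmeas := measurable_fromEdgeSet_ofPred (V := V)
  -- `fromEdgeSet` discards loops, so the edge indicator is the coordinate cut down by `¬ e.IsDiag`.
  -- It still depends on one coordinate only.
  have hind : iIndepFun (fun (e : Sym2 V) (ω : Sym2 V → Prop) => ω e ∧ ¬ e.IsDiag)
      (pairMeasure V p) :=
    iIndepFun_infinitePi (X := fun (e : Sym2 V) b => b ∧ ¬ e.IsDiag) fun e =>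
      Measurable.of_discrete
  rw [iIndepFun_iff_measure_inter_preimage_eq_mul] at hind ⊢
  intro S sets _
  have key := hind S (sets := sets) fun _ _ => MeasurableSet.of_discrete
  rw [binomialRandom_eq_map_pairMeasure, Measure.map_apply hmeas MeasurableSet.of_discrete]
  simp_rw [Measure.map_apply hmeas (MeasurableSet.of_discrete)]
  have aux : ∀ e, (fun ω : Sym2 V → Prop ↦ fromEdgeSet {e | ω e}) ⁻¹'
      ((fun G : SimpleGraph V => e ∈ G.edgeSet) ⁻¹' sets e) =
      (fun ω => ω e ∧ ¬ e.IsDiag) ⁻¹' sets e := by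
    intro e; ext ω; simp [edgeSet_fromEdgeSet]
  simp_rw [Set.preimage_iInter, aux]
  exact key

/-- Such a function factors through the restriction of the edge indicators to `U`. That restriction
takes values in a finite space, where every set is measurable. -/
lemma measurableSet_comap_of_determined {γ : Type*} {U : Set (Sym2 V)} {k : SimpleGraph V → γ}
    (hk : ∀ G G' : SimpleGraph V, (∀ e ∈ U, e ∈ G.edgeSet ↔ e ∈ G'.edgeSet) → k G = k G')
    (s : Set γ) : MeasurableSet[MeasurableSpace.comap
      (fun (G : SimpleGraph V) (e : U.toFinite.toFinset) => (e : Sym2 V) ∈ G.edgeSet)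
      inferInstance] (k ⁻¹' s) := by
  refine ⟨(fun (G : SimpleGraph V) (e : U.toFinite.toFinset) => (e : Sym2 V) ∈ G.edgeSet) ''
    (k ⁻¹' s), (Set.toFinite _).measurableSet, ?_⟩
  ext G
  constructor
  · rintro ⟨G', hG', hGG'⟩
    have : k G' = k G := hk _ _ fun e he => by
      simpa using congrFun hGG' ⟨e, by simpa using he⟩
    simpa [this] using hG'
  · exact fun hG => ⟨G, hG, rfl⟩

lemma indepFun_of_determined {α β : Type*} [MeasurableSpace α] [MeasurableSpace β]
    {S T : Set (Sym2 V)} (hST : Disjoint S T) {f : SimpleGraph V → α} {g : SimpleGraph V → β}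
    (hf : ∀ G G' : SimpleGraph V, (∀ e ∈ S, e ∈ G.edgeSet ↔ e ∈ G'.edgeSet) → f G = f G')
    (hg : ∀ G G' : SimpleGraph V, (∀ e ∈ T, e ∈ G.edgeSet ↔ e ∈ G'.edgeSet) → g G = g G') :
    IndepFun f g (binomialRandom V p) := by
  have h := (iIndepFun_mem_edgeSet (V := V) p).indepFun_finset S.toFinite.toFinset
    T.toFinite.toFinset (by simpa using hST) (fun _ => Measurable.of_discrete)
  rw [IndepFun_iff] at h ⊢
  rintro _ _ ⟨s, _, rfl⟩ ⟨t, _, rfl⟩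
  exact h _ _ (measurableSet_comap_of_determined hf s) (measurableSet_comap_of_determined hg t)

lemma DeterminedBy.measureReal_inter {E F : Set (SimpleGraph V)} {S T : Set (Sym2 V)}
    (h : DeterminedBy E S) (h' : DeterminedBy F T) (hST : Disjoint S T) :
    (binomialRandom V p).real (E ∩ F) =
      (binomialRandom V p).real E * (binomialRandom V p).real F := by
  have := (indepFun_of_determined p hST (f := fun G => G ∈ E) (g := fun G => G ∈ F)
    h.eq_mem h'.eq_mem).measure_inter_preimage_eq_mul {True} {True}
    MeasurableSet.of_discrete MeasurableSet.of_discrete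
  have aux : ∀ E : Set (SimpleGraph V), (fun G => G ∈ E) ⁻¹' {True} = E := by
    intro E; ext; simp
  rw [aux, aux] at this
  rw [measureReal_def, this, ENNReal.toReal_mul]
  rfl

/-- Events determined by pairwise disjoint sets of pairs are mutually independent. -/
lemma measureReal_biInter_of_determinedBy {ι : Type*} (B : Finset ι)
    {E : ι → Set (SimpleGraph V)} {S : ι → Set (Sym2 V)}
    (h : ∀ b ∈ B, DeterminedBy (E b) (S b)) (hS : (B : Set ι).PairwiseDisjoint S) :
    (binomialRandom V p).real (⋂ b ∈ B, E b) = ∏ b ∈ B, (binomialRandom V p).real (E b) := by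
  classical
  induction B using Finset.induction_on with
  | empty => simp
  | insert a B ha ih =>
    have hB : DeterminedBy (⋂ b ∈ B, E b) (⋃ b ∈ B, S b) :=
      DeterminedBy.iInter (B := (B : Set ι)) fun b hb => h b (by simp_all)
    rw [Finset.set_biInter_insert, Finset.prod_insert ha,
      (h a (by simp)).measureReal_inter p hB, ih]
    · exact fun b hb => h b (by simp [hb])
    · exact hS.subset (by simp)
    · rw [Set.disjoint_iUnion₂_right]
      intro b hb
      refine hS (by simp) (by simp_all) ?_
      rintro rfl
      exact ha hb

lemma measureReal_mem_edgeSet {e : Sym2 V} (he : ¬ e.IsDiag) :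
    (binomialRandom V p).real {G | e ∈ G.edgeSet} = p := by
  rw [measureReal_def, binomialRandom_eq_map_pairMeasure,
    Measure.map_apply measurable_fromEdgeSet_ofPred MeasurableSet.of_discrete]
  have : (fun ω : Sym2 V → Prop ↦ fromEdgeSet {e | ω e}) ⁻¹' {G | e ∈ G.edgeSet} =
      (fun ω => ω e) ⁻¹' {True} := by
    ext ω; simp [edgeSet_fromEdgeSet, he]
  rw [this, ← Measure.map_apply (by fun_prop) MeasurableSet.of_discrete,
    pairMeasure, Measure.infinitePi_map_eval]
  simp [he]

lemma measureReal_notMem_edgeSet {e : Sym2 V} (he : ¬ e.IsDiag) :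
    (binomialRandom V p).real {G | e ∉ G.edgeSet} = 1 - p := by
  rw [← measureReal_mem_edgeSet p he, ← probReal_compl_eq_one_sub MeasurableSet.of_discrete]
  rfl

lemma measureReal_subset_edgeSet (T : Finset (Sym2 V)) (hT : ∀ e ∈ T, ¬ e.IsDiag) :
    (binomialRandom V p).real {G | ∀ e ∈ T, e ∈ G.edgeSet} = (p : ℝ) ^ T.card := by
  have := measureReal_biInter_of_determinedBy p T (fun e _ => determinedBy_mem e)
    (by intro a _ b _ hab; simpa using hab)
  rw [Finset.prod_congr rfl fun e he => measureReal_mem_edgeSet p (hT e he)] at this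
  simpa [Set.ofPred_forall] using this

lemma measureReal_forall_notMem_edgeSet (T : Finset (Sym2 V)) (hT : ∀ e ∈ T, ¬ e.IsDiag) :
    (binomialRandom V p).real {G | ∀ e ∈ T, e ∉ G.edgeSet} = (1 - p : ℝ) ^ T.card := by
  have := measureReal_biInter_of_determinedBy p T (fun e _ => (determinedBy_mem e).compl)
    (by intro a _ b _ hab; simpa using hab)
  have h2 : ∀ e ∈ T, (binomialRandom V p).real {G | e ∈ G.edgeSet}ᶜ = 1 - p := fun e he =>
    measureReal_notMem_edgeSet p (hT e he)
  rw [Finset.prod_congr rfl h2] at this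
  simpa [Set.ofPred_forall, Set.compl_ofPred] using this

lemma measureReal_exists_mem_edgeSet (T : Finset (Sym2 V)) (hT : ∀ e ∈ T, ¬ e.IsDiag) :
    (binomialRandom V p).real {G | ∃ e ∈ T, e ∈ G.edgeSet} = 1 - (1 - p : ℝ) ^ T.card := by
  rw [← measureReal_forall_notMem_edgeSet p T hT,
    ← probReal_compl_eq_one_sub MeasurableSet.of_discrete]
  congr 1
  ext G; simp

open scoped Classical in
/-- Chebyshev's inequality for the number of occurring events in a family of events with common
probability `q`, determined by pairwise disjoint sets of pairs. -/
lemma measureReal_card_le_of_determinedBy {ι : Type*} (B : Finset ι)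
    {E : ι → Set (SimpleGraph V)} {S : ι → Set (Sym2 V)}
    (h : ∀ b ∈ B, DeterminedBy (E b) (S b)) (hS : (B : Set ι).PairwiseDisjoint S)
    {q θ : ℝ} (hq : ∀ b ∈ B, (binomialRandom V p).real (E b) = q) (hθ : θ < B.card * q) :
    (binomialRandom V p).real {G | (({b ∈ B | G ∈ E b}.card : ℕ) : ℝ) ≤ θ} ≤
      B.card * q / (B.card * q - θ) ^ 2 := by
  set μ := binomialRandom V p
  set X : ι → SimpleGraph V → ℝ := fun b => (E b).indicator 1
  have hmem : ∀ b, MemLp (X b) 2 μ := fun b =>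
    memLp_top_const (1 : ℝ) |>.mono_exponent (p := 2) le_top |>.indicator MeasurableSet.of_discrete
  have hint : ∀ b ∈ B, ∫ G, X b G ∂μ = q := by
    intro b hb
    rw [← hq b hb, integral_indicator_one MeasurableSet.of_discrete]
  have hvar : variance (∑ b ∈ B, X b) μ ≤ B.card * q := by
    rw [IndepFun.variance_sum (fun b _ => hmem b), ← nsmul_eq_mul]
    · refine Finset.sum_le_card_nsmul _ _ _ fun b hb => ?_
      refine (variance_le_expectation_sq (hmem b).aestronglyMeasurable).trans ?_
      rw [← hint b hb]
      refine le_of_eq (integral_congr_ae (.of_forall fun G => ?_))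
      by_cases hG : G ∈ E b <;> simp [X, hG]
    · intro a ha b hb hab
      refine indepFun_of_determined p (hS ha hb hab) ?_ ?_
      · intro G G' hG
        have := (h a ha).eq_mem G G' hG
        simp only [X, Set.indicator, this, Pi.one_apply]
      · intro G G' hG
        have := (h b hb).eq_mem G G' hG
        simp only [X, Set.indicator, this, Pi.one_apply]
  have hE : ∫ G, (∑ b ∈ B, X b) G ∂μ = B.card * q := by
    simp only [Finset.sum_apply]
    rw [integral_finsetSum _ fun b _ => (hmem b).integrable (by norm_num),
      Finset.sum_congr rfl hint]
    simp
  have hpos : 0 < B.card * q - θ := by linarith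
  have hcheb := meas_ge_le_variance_div_sq (memLp_finsetSum' B fun b _ => hmem b) hpos
  rw [hE] at hcheb
  refine (measureReal_mono (s₂ := {G | B.card * q - θ ≤ |(∑ b ∈ B, X b) G - B.card * q|})
    ?_).trans ?_
  · intro G hG
    have : (∑ b ∈ B, X b) G = (({b ∈ B | G ∈ E b}.card : ℕ) : ℝ) := by
      simp [X, Set.indicator_apply]
    simp only [Set.mem_ofPred_eq] at hG ⊢
    rw [this, abs_sub_comm]
    refine le_trans ?_ (le_abs_self _)
    linarith
  · rw [measureReal_def]
    refine (ENNReal.toReal_mono (by simp) hcheb).trans ?_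
    rw [ENNReal.toReal_ofReal (div_nonneg (variance_nonneg _ _) (sq_nonneg _))]
    gcongr

end Finite

end SimpleGraph

namespace SimpleGraph

/-! ### Elementary bounds for `exIn` -/

section ExIn

variable {V W : Type*} [Fintype V]

lemma ncard_edgeSet_le_exIn {G H : SimpleGraph V} {F : SimpleGraph W} (hHG : H ≤ G)
    (hF : F.Free H) : H.edgeSet.ncard ≤ G.exIn F := by
  classical
  rw [exIn, ← coe_edgeFinset, Set.ncard_coe_finset]
  convert Finset.le_sup (f := fun H : SimpleGraph V ↦ H.edgeFinset.card) (b := H) ?_ using 2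
  simpa [hHG] using hF

lemma exIn_le {G : SimpleGraph V} {F : SimpleGraph W} {t : ℕ}
    (h : ∀ H ≤ G, F.Free H → H.edgeSet.ncard ≤ t) : G.exIn F ≤ t := by
  classical
  refine Finset.sup_le fun H hH => ?_
  simp only [Finset.mem_filter, Finset.mem_univ, true_and] at hH
  refine le_trans (le_of_eq ?_) (h H hH.1 hH.2)
  rw [← coe_edgeFinset, Set.ncard_coe_finset]

lemma exIn_le_ncard_edgeSet (G : SimpleGraph V) (F : SimpleGraph W) :
    G.exIn F ≤ G.edgeSet.ncard :=
  exIn_le fun _ hH _ => Set.ncard_le_ncard (edgeSet_mono hH)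

end ExIn

/-! ### Depth-first search and the deterministic upper bound -/

section DepthFirstSearch

variable {V : Type*} {H : SimpleGraph V}

lemma length_le_of_pathGraph_free {n : ℕ} (hF : (pathGraph (n + 1)).Free H) {p : List V}
    (hc : p.IsChain H.Adj) (hp : p.Nodup) : p.length ≤ n := by
  by_contra! hlt
  refine hF ⟨⟨⟨fun i : Fin (n + 1) => p[i.1], ?_⟩, ?_⟩⟩
  · intro a b hab
    rw [pathGraph_adj] at hab
    rw [List.isChain_iff_getElem] at hc
    rcases hab with h | h
    · have := hc a.1 (by omega)
      simpa [h] using this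
    · have := hc b.1 (by omega)
      simpa [h] using this.symm
  · intro a b hab
    exact Fin.ext ((hp.getElem_inj_iff).1 hab)

/-- A state of a depth-first search in `H`: `p` is the current stack, a path of discovered
vertices, and `U` is the set of undiscovered vertices, which sends no edges to finished ones. -/
structure IsSearchState (H : SimpleGraph V) (p : List V) (U : Finset V) : Prop where
  isChain : p.IsChain H.Adj
  nodup : p.Nodup
  notMem : ∀ x ∈ p, x ∉ U
  adj : ∀ x ∈ U, ∀ y, H.Adj x y → y ∈ U ∨ y ∈ p

variable [DecidableEq V]

/-- The head of the list is the top of the stack. While the top has no undiscovered neighbour it is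
finished and popped, which keeps the invariant. Then a neighbour of the top is pushed, or any
undiscovered vertex if the stack has become empty. Here `q` is the stack just before `u` is pushed.
-/
lemma IsSearchState.exists_next {p : List V} {U : Finset V} (h : IsSearchState H p U)
    (hU : U.Nonempty) : ∃ u ∈ U, ∃ q : List V, (∀ y ∈ q, y ∈ p) ∧
      IsSearchState H (u :: q) (U.erase u) ∧ ∀ x ∈ U, ∀ y, H.Adj x y → y ∈ U ∨ y ∈ q := by
  induction p with
  | nil =>
    obtain ⟨u, hu⟩ := hU
    refine ⟨u, hu, [], by simp, ⟨by simp, by simp, by simp, ?_⟩, h.adj⟩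
    intro x hx y hxy
    have := h.adj x (Finset.mem_of_mem_erase hx) y hxy
    simp at this ⊢
    tauto
  | cons a p ih =>
    by_cases ha : ∃ u ∈ U, H.Adj u a
    · obtain ⟨u, hu, hua⟩ := ha
      refine ⟨u, hu, a :: p, by simp, ⟨?_, ?_, ?_, ?_⟩, h.adj⟩
      · exact List.IsChain.cons_cons hua h.isChain
      · refine List.nodup_cons.2 ⟨fun hm => h.notMem u hm hu, h.nodup⟩
      · intro x hx hxU
        rcases List.mem_cons.1 hx with rfl | hx
        · simp at hxU
        · exact h.notMem x hx (Finset.mem_of_mem_erase hxU)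
      · intro x hx y hxy
        have := h.adj x (Finset.mem_of_mem_erase hx) y hxy
        simp only [Finset.mem_erase, List.mem_cons] at this ⊢
        tauto
    · push Not at ha
      obtain ⟨u, hu, q, hq, hs, hadj⟩ := ih ⟨h.isChain.tail, h.nodup.of_cons,
        fun x hx => h.notMem x (List.mem_cons_of_mem _ hx), fun x hx y hxy => by
          rcases h.adj x hx y hxy with hy | hy
          · exact .inl hy
          · rcases List.mem_cons.1 hy with rfl | hy
            · exact absurd hxy (ha x hx)
            · exact .inr hy⟩
      exact ⟨u, hu, q, fun y hy => List.mem_cons_of_mem _ (hq y hy), hs, hadj⟩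

/-- Running a depth-first search until `k` more vertices are discovered. -/
lemma IsSearchState.exists_block {p : List V} {U : Finset V} (h : IsSearchState H p U) (k : ℕ)
    (hk : k ≤ U.card) : ∃ (q : List V) (U' : Finset V), U' ⊆ U ∧ U'.card + k = U.card ∧
      IsSearchState H q U' ∧ (∀ y ∈ q, y ∈ p ∨ y ∈ U \ U') ∧
      ∀ x ∈ U \ U', ∀ y ∉ U', H.Adj x y → y ∈ p ∨ y ∈ U \ U' := by
  induction k with
  | zero => exact ⟨p, U, subset_rfl, by simp, h, fun y hy => .inl hy, by simp⟩
  | succ k ih =>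
    obtain ⟨q, U', hU', hcard, hs, hq, hadj⟩ := ih (by omega)
    obtain ⟨u, hu, q', hq', hs', hadj'⟩ := hs.exists_next (Finset.card_pos.1 (by omega))
    refine ⟨u :: q', U'.erase u, (Finset.erase_subset _ _).trans hU', ?_, hs', ?_, ?_⟩
    · rw [Finset.card_erase_of_mem hu]
      have := Finset.card_pos.2 ⟨u, hu⟩
      omega
    · intro y hy
      rcases List.mem_cons.1 hy with rfl | hy
      · exact .inr (by simp [hU' hu])
      · rcases hq y (hq' y hy) with h1 | h1
        · exact .inl h1
        · exact .inr (by simp at h1 ⊢; tauto)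
    · intro x hx y hy hxy
      by_cases hyU : y ∈ U'
      · have : y = u := by simp at hy; tauto
        subst this
        exact .inr (by simp [hU' hyU])
      by_cases hxU : x ∈ U'
      · have : x = u := by simp at hx; tauto
        subst this
        rcases hadj' x hxU y hxy with h1 | h1
        · exact absurd h1 hyU
        · rcases hq y (hq' y h1) with h2 | h2
          · exact .inl h2
          · exact .inr (by simp at h2 ⊢; tauto)
      · rcases hadj x (by simp at hx ⊢; tauto) y hyU hxy with h1 | h1
        · exact .inl h1
        · exact .inr (by simp at h1 ⊢; tauto)

lemma IsSearchState.ncard_edges_le [Finite V] {n t : ℕ} (hF : (pathGraph (n + 1)).Free H)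
    (ht : ∀ A : Finset V, A.card ≤ 2 * n → {e ∈ H.edgeSet | ∀ x ∈ e, x ∈ A}.ncard ≤ t)
    (b : ℕ) {p : List V} {U : Finset V} (h : IsSearchState H p U) (hb : U.card ≤ b * n) :
    {e ∈ H.edgeSet | ∃ x ∈ e, x ∈ U}.ncard ≤ b * t := by
  induction b generalizing p U with
  | zero =>
    have : U = ∅ := Finset.card_eq_zero.1 (by omega)
    simp [this]
  | succ b ih =>
    -- The last block may be shorter than `n`. An edge meeting `U` but not `U'` has both ends in the
    -- stack `p` or in the block `U \ U'`, each of size at most `n`.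
    obtain ⟨q, U', hU', hcard, hs, -, hadj⟩ := h.exists_block (min n U.card) (min_le_right _ _)
    have h1 := ih hs (by rw [add_mul] at hb; omega)
    have hdiff : (U \ U').card ≤ n := by
      rw [Finset.card_sdiff_of_subset hU']; omega
    have hlen := length_le_of_pathGraph_free hF h.isChain h.nodup
    have h2 := ht (p.toFinset ∪ (U \ U')) (by
      refine (Finset.card_union_le _ _).trans ?_
      have := p.toFinset_card_le
      omega)
    have hsub : {e ∈ H.edgeSet | ∃ x ∈ e, x ∈ U} ⊆ {e ∈ H.edgeSet | ∃ x ∈ e, x ∈ U'} ∪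
        {e ∈ H.edgeSet | ∀ x ∈ e, x ∈ p.toFinset ∪ (U \ U')} := by
      rintro e ⟨he, x, hxe, hxU⟩
      by_cases hU'e : ∃ y ∈ e, y ∈ U'
      · exact .inl ⟨he, hU'e⟩
      · push Not at hU'e
        refine .inr ⟨he, fun y hye => ?_⟩
        have hx : x ∈ U \ U' := by simp [hxU, hU'e x hxe]
        by_cases hxy : x = y
        · subst hxy; exact Finset.mem_union_right _ hx
        · have hadj' : H.Adj x y := by
            rw [← mem_edgeSet, ← (Sym2.mem_and_mem_iff hxy).1 ⟨hxe, hye⟩]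
            exact he
          rcases hadj x hx y (hU'e y hye) hadj' with h3 | h3
          · exact Finset.mem_union_left _ (by simpa using h3)
          · exact Finset.mem_union_right _ h3
    calc _ ≤ _ := Set.ncard_le_ncard hsub (Set.toFinite _)
      _ ≤ _ := Set.ncard_union_le _ _
      _ ≤ b * t + t := add_le_add h1 h2
      _ = _ := by ring

end DepthFirstSearch

/-- If every set of `2 * n` vertices spans at most `t` edges of `G`, then a subgraph of `G` without
a path on `n + 1` vertices has at most `(N / n + 1) * t` edges. -/
lemma exIn_pathGraph_le {V : Type*} [Fintype V] {G : SimpleGraph V} {n t : ℕ} (hn : 0 < n)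
    (ht : ∀ A : Finset V, A.card ≤ 2 * n → {e ∈ G.edgeSet | ∀ x ∈ e, x ∈ A}.ncard ≤ t) :
    G.exIn (pathGraph (n + 1)) ≤ (Fintype.card V / n + 1) * t := by
  classical
  refine exIn_le fun H hHG hF => ?_
  have hs : IsSearchState H [] Finset.univ := ⟨by simp, by simp, by simp, by simp⟩
  have := hs.ncard_edges_le hF (t := t) (fun A hA => le_trans
    (Set.ncard_le_ncard (Set.inter_subset_inter_left _ (edgeSet_mono hHG))) (ht A hA))
    (Fintype.card V / n + 1) (by
      rw [Finset.card_univ]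
      exact (Nat.lt_mul_of_div_lt (Nat.lt_succ_self _) hn).le)
  convert this using 2
  ext e
  induction e with | _ x y => simp

/-! ### Subgraphs without long paths -/

section Constructions

variable {V : Type*}

/-- The label `f` is constant along a path, so its n+1 vertices would lie in one fibre. The label
`none` marks isolated vertices, and its fibre may be large. -/
lemma pathGraph_free_of_fibers [Finite V] {ι : Type*} {H : SimpleGraph V} {n : ℕ} (hn : 0 < n)
    (f : V → Option ι) (hf : ∀ x y, H.Adj x y → f x = f y ∧ f x ≠ none)
    (hcard : ∀ i, {x | f x = some i}.ncard ≤ n) : (pathGraph (n + 1)).Free H := by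
  rintro ⟨φ⟩
  have hconst : ∀ k : ℕ, ∀ hk : k < n + 1, f (φ ⟨k, hk⟩) = f (φ 0) := by
    intro k
    induction k with
    | zero => intro _; rfl
    | succ k ih =>
      intro hk
      rw [← ih (by omega)]
      refine (hf _ _ (φ.toHom.map_adj ?_)).1
      simp [pathGraph_adj]
  obtain ⟨i, hi⟩ := Option.ne_none_iff_exists'.1
    (hf (φ 0) (φ ⟨1, by omega⟩) (φ.toHom.map_adj (by simp [pathGraph_adj]))).2
  have h1 : (Set.range φ).ncard ≤ n := by
    refine (Set.ncard_le_ncard ?_ (Set.toFinite _)).trans (hcard i)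
    rintro _ ⟨k, rfl⟩
    exact (hconst k.1 k.2).trans hi
  have h2 : (Set.range φ).ncard = Nat.card (Fin (n + 1)) :=
    Set.ncard_range_of_injective φ.injective
  rw [h2] at h1
  simp at h1

/-- Four consecutive vertices already give a contradiction: one end of the middle edge is a leaf in
`R`, and both of its path neighbours would have to equal its centre under `g`. -/
lemma pathGraph_free_of_stars {H : SimpleGraph V} {n : ℕ} (hn : 3 ≤ n) (R : Set V) (g : V → V)
    (hH : ∀ x y, H.Adj x y → (x ∈ R ∧ y ∉ R ∧ y = g x) ∨ (y ∈ R ∧ x ∉ R ∧ x = g y)) :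
    (pathGraph (n + 1)).Free H := by
  rintro ⟨φ⟩
  have hadj : ∀ k : ℕ, ∀ hk : k + 1 < n + 1, H.Adj (φ ⟨k, by omega⟩) (φ ⟨k + 1, hk⟩) := by
    intro k hk
    exact φ.toHom.map_adj (by simp [pathGraph_adj])
  have hne : ∀ k : ℕ, ∀ hk : k + 2 < n + 1, φ ⟨k, by omega⟩ ≠ φ ⟨k + 2, hk⟩ := by
    intro k hk h
    simpa using φ.injective h
  have h01 := hH _ _ (hadj 0 (by omega))
  have h12 := hH _ _ (hadj 1 (by omega))
  have h23 := hH _ _ (hadj 2 (by omega))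
  have n02 := hne 0 (by omega)
  have n13 := hne 1 (by omega)
  simp only [Nat.reduceAdd] at h01 h12 h23 n02 n13
  rcases h12 with ⟨h1, h2, h3⟩ | ⟨h1, h2, h3⟩
  · rcases h01 with ⟨-, h, -⟩ | ⟨-, -, h⟩
    · exact h h1
    · exact n02 (h.trans h3.symm)
  · rcases h23 with ⟨-, -, h⟩ | ⟨-, h, -⟩
    · exact n13 (h3.trans h.symm)
    · exact h h1

open scoped Classical in
/-- Vertices of `R` with a neighbour outside `R` are the leaves of a star forest. -/
lemma card_filter_exists_adj_le_exIn [Fintype V] (G : SimpleGraph V) {n : ℕ} (hn : 3 ≤ n)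
    (R : Finset V) : {v ∈ R | ∃ w ∉ R, G.Adj v w}.card ≤ G.exIn (pathGraph (n + 1)) := by
  have hex : ∀ v, ∃ w, v ∈ R → (∃ w ∉ R, G.Adj v w) → w ∉ R ∧ G.Adj v w := by
    intro v
    by_cases h : ∃ w ∉ R, G.Adj v w
    · obtain ⟨w, hw⟩ := h
      exact ⟨w, fun _ _ => hw⟩
    · exact ⟨v, fun _ h' => absurd h' h⟩
  choose g hg using hex
  let H : SimpleGraph V :=
    { Adj := fun x y => G.Adj x y ∧ ((x ∈ R ∧ y ∉ R ∧ y = g x) ∨ (y ∈ R ∧ x ∉ R ∧ x = g y))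
      symm := ⟨fun x y h => ⟨h.1.symm, h.2.symm⟩⟩
      loopless := ⟨fun x h => h.1.ne rfl⟩ }
  have hHG : H ≤ G := fun x y h => h.1
  have hfree := pathGraph_free_of_stars hn (H := H) R g fun x y h => h.2
  refine le_trans ?_ (ncard_edgeSet_le_exIn hHG hfree)
  rw [← Set.ncard_coe_finset]
  refine Set.ncard_le_ncard_of_injOn (fun v => s(v, g v)) ?_ ?_
  · intro v hv
    simp only [Finset.coe_filter, Set.mem_ofPred_eq] at hv
    obtain ⟨h1, h2⟩ := hg v hv.1 hv.2
    exact ⟨h2, .inl ⟨hv.1, h1, rfl⟩⟩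
  · intro v hv w hw hvw
    simp only [Finset.coe_filter, Set.mem_ofPred_eq] at hv hw
    rcases Sym2.eq_iff.1 hvw with h | h
    · exact h.1
    · exact absurd hv.1 (h.1 ▸ (hg w hw.1 hw.2).1)

/-- The vertex `φ (inr v)` has a neighbour in each of the `d` groups of the `i`-th cell. -/
def IsGood {m d k r : ℕ} (G : SimpleGraph V) (φ : (Fin m × Fin d × Fin k) ⊕ Fin r ↪ V)
    (i : Fin m) (v : Fin r) : Prop :=
  ∀ j, ∃ l, G.Adj (φ (.inl (i, j, l))) (φ (.inr v))

/-- The pieces are the cells with their assigned outer vertices, of size at most d * k + s ≤ n. An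
assigned vertex has an edge into each of the `d` groups of its cell, and these edges are distinct.
-/
lemma card_assigned_mul_le_exIn [Fintype V] (G : SimpleGraph V) {m d k r s n : ℕ} (hn : 0 < n)
    (φ : (Fin m × Fin d × Fin k) ⊕ Fin r ↪ V) (hdk : d * k + s ≤ n) (a : Fin r → Option (Fin m))
    (ha : ∀ v i, a v = some i → IsGood G φ i v)
    (hs : ∀ i, (Finset.univ.filter fun v => a v = some i).card ≤ s) :
    (Finset.univ.filter fun v => a v ≠ none).card * d ≤ G.exIn (pathGraph (n + 1)) := by
  classical
  let f₀ : (Fin m × Fin d × Fin k) ⊕ Fin r → Option (Fin m) :=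
    Sum.elim (fun x => some x.1) a
  -- Vertices outside the range of `φ` get `none` and are isolated in `H`.
  let f : V → Option (Fin m) := Function.extend φ f₀ fun _ => none
  have hfφ : ∀ z, f (φ z) = f₀ z := fun z => φ.injective.extend_apply _ _ _
  let H : SimpleGraph V :=
    { Adj := fun x y => G.Adj x y ∧ f x = f y ∧ f x ≠ none
      symm := ⟨fun x y h => ⟨h.1.symm, h.2.1.symm, h.2.1 ▸ h.2.2⟩⟩
      loopless := ⟨fun x h => h.1.ne rfl⟩ }
  have hHG : H ≤ G := fun x y h => h.1
  have hfree := pathGraph_free_of_fibers (H := H) hn f (fun x y h => h.2) (fun i => by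
    let T : Finset ((Fin m × Fin d × Fin k) ⊕ Fin r) :=
      Finset.disjSum ({i} ×ˢ Finset.univ) (Finset.univ.filter fun v => a v = some i)
    have hT : {x | f x = some i} ⊆ (T.map φ : Finset V) := by
      intro x hx
      by_cases hxφ : ∃ z, φ z = x
      · obtain ⟨z, rfl⟩ := hxφ
        simp only [Set.mem_ofPred_eq, hfφ] at hx
        refine Finset.mem_coe.2 (Finset.mem_map_of_mem _ ?_)
        rcases z with ⟨z1, z2⟩ | z
        · simp [T, f₀] at hx ⊢; exact hx.symm
        · simp [T, f₀] at hx ⊢; exact hx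
      · simp only [Set.mem_ofPred_eq, f, Function.extend_apply' _ _ _ hxφ] at hx
        simp at hx
    refine (Set.ncard_le_ncard hT (Set.toFinite _)).trans ?_
    rw [Set.ncard_coe_finset, Finset.card_map, Finset.card_disjSum]
    have := hs i
    simp
    omega)
  refine le_trans ?_ (ncard_edgeSet_le_exIn hHG hfree)
  have hex : ∀ (v : Fin r) (j : Fin d), ∃ y, a v ≠ none → ∃ z : Fin m × Fin d × Fin k,
      y = φ (.inl z) ∧ a v = some z.1 ∧ z.2.1 = j ∧ G.Adj (φ (.inl z)) (φ (.inr v)) := by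
    intro v j
    rcases hv : a v with _ | i
    · exact ⟨φ (.inr v), by simp⟩
    · obtain ⟨l, hl⟩ := ha v i hv j
      exact ⟨_, fun _ => ⟨(i, j, l), rfl, rfl, rfl, hl⟩⟩
  choose g hg using hex
  have hcard : ((Finset.univ.filter fun v => a v ≠ none) ×ˢ (Finset.univ : Finset (Fin d))).card =
      (Finset.univ.filter fun v => a v ≠ none).card * d := by
    rw [Finset.card_product]; simp
  rw [← hcard, ← Set.ncard_coe_finset]
  refine Set.ncard_le_ncard_of_injOn
    (fun w : Fin r × Fin d => s(φ (.inr w.1), g w.1 w.2)) ?_ ?_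
  · rintro ⟨v, j⟩ hv
    have hv' : a v ≠ none := by simpa using hv
    obtain ⟨z, h0, h1, -, h3⟩ := hg v j hv'
    simp only [h0]
    refine ⟨h3.symm, ?_⟩
    simp only [hfφ, f₀, Sum.elim_inl, Sum.elim_inr]
    exact ⟨h1, hv'⟩
  · rintro ⟨v, j⟩ hv ⟨w, l⟩ hw hvw
    obtain ⟨z, h0, -, h1, -⟩ := hg v j (by simpa using hv)
    obtain ⟨z', h0', -, h1', -⟩ := hg w l (by simpa using hw)
    simp only [h0, h0', Sym2.eq_iff, φ.injective.eq_iff, Sum.inr.injEq, Sum.inl.injEq,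
      reduceCtorEq, false_and, or_false] at hvw
    rw [Prod.mk.injEq]
    exact ⟨hvw.1, by rw [← h1, ← h1', hvw.2]⟩

/-- If every large set of cells and every large set of outer vertices contain a good pair, then a
maximal assignment fills half of the cells. -/
lemma mul_le_two_mul_exIn [Fintype V] (G : SimpleGraph V) {m d k r s n : ℕ} (hn : 0 < n)
    (φ : (Fin m × Fin d × Fin k) ⊕ Fin r ↪ V) (hdk : d * k + s ≤ n)
    (h : ∀ (I : Finset (Fin m)) (U : Finset (Fin r)), m ≤ 2 * I.card → r ≤ U.card + m * s →
      ∃ i ∈ I, ∃ v ∈ U, IsGood G φ i v) :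
    m * s * d ≤ 2 * G.exIn (pathGraph (n + 1)) := by
  classical
  let P : (Fin r → Option (Fin m)) → Prop := fun a =>
    (∀ v i, a v = some i → IsGood G φ i v) ∧
      ∀ i, (Finset.univ.filter fun v => a v = some i).card ≤ s
  obtain ⟨a, haP, hmax⟩ := Finset.exists_max_image (Finset.univ.filter P)
    (fun a => (Finset.univ.filter fun v => a v ≠ none).card)
    ⟨fun _ => none, by simp [P]⟩
  have ha : P a := by simpa using haP
  have hle := card_assigned_mul_le_exIn G hn φ hdk a ha.1 ha.2
  set I : Finset (Fin m) :=
    Finset.univ.filter fun i => (Finset.univ.filter fun v => a v = some i).card < s with hI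
  set U : Finset (Fin r) := Finset.univ.filter fun v => a v = none with hU
  have hsum : (Finset.univ.filter fun v => a v ≠ none).card =
      ∑ i, (Finset.univ.filter fun v => a v = some i).card := by
    rw [← Finset.card_biUnion]
    · congr 1
      ext v
      simp [Option.ne_none_iff_exists']
    · intro i _ j _ hij
      rw [Function.onFun, Finset.disjoint_left]
      intro v hv hv'
      simp at hv hv'
      exact hij (Option.some_injective _ (hv.symm.trans hv'))
  have hcompl : U.card + (Finset.univ.filter fun v => a v ≠ none).card = r := by
    have := Finset.card_filter_add_card_filter_not (s := (Finset.univ : Finset (Fin r)))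
      (fun v => a v = none)
    simpa using this
  have hupper : (Finset.univ.filter fun v => a v ≠ none).card ≤ m * s := by
    rw [hsum]
    refine (Finset.sum_le_card_nsmul _ _ s fun i _ => ha.2 i).trans (by simp)
  have hlower : (m - I.card) * s ≤ (Finset.univ.filter fun v => a v ≠ none).card := by
    rw [hsum]
    have h1 : Iᶜ.card = m - I.card := by rw [Finset.card_compl]; simp
    rw [← h1, ← smul_eq_mul]
    refine (Finset.card_nsmul_le_sum Iᶜ _ s fun i hi => ?_).trans
      (Finset.sum_le_sum_of_subset (Finset.subset_univ _))
    simpa [hI] using hi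
  -- Otherwise half of the cells have room. At most m * s vertices are assigned, so `U` is large
  -- too, and a good pair in `I` × `U` would extend the maximal assignment.
  have hsmall : ¬ m ≤ 2 * I.card := by
    intro hbig
    obtain ⟨i, hi, v, hv, hgood⟩ := h I U hbig (by omega)
    have hvnone : a v = none := by simpa [hU] using hv
    have hi' : (Finset.univ.filter fun v => a v = some i).card < s := by simpa [hI] using hi
    have hP : P (Function.update a v (some i)) := by
      constructor
      · intro w j hw
        by_cases hwv : w = v
        · subst hwv
          simp at hw
          exact hw ▸ hgood
        · rw [Function.update_of_ne hwv] at hw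
          exact ha.1 w j hw
      · intro j
        by_cases hj : j = i
        · subst hj
          refine le_trans (Finset.card_le_card (t := insert v
            (Finset.univ.filter fun v => a v = some j)) ?_)
            ((Finset.card_insert_le _ _).trans hi')
          intro w hw
          by_cases hwv : w = v
          · simp [hwv]
          · simp [Function.update_of_ne hwv] at hw
            simp [hw]
        · refine le_trans (Finset.card_le_card ?_) (ha.2 j)
          intro w hw
          by_cases hwv : w = v
          · subst hwv
            simp at hw
            exact absurd hw.symm hj
          · simpa [Function.update_of_ne hwv] using hw
    have hlt : (Finset.univ.filter fun w => a w ≠ none).card <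
        (Finset.univ.filter fun w => Function.update a v (some i) w ≠ none).card := by
      refine Finset.card_lt_card ((Finset.ssubset_iff_of_subset ?_).2 ⟨v, by simp, by simp [hvnone]⟩)
      intro w hw
      by_cases hwv : w = v
      · simp [hwv]
      · simpa [Function.update_of_ne hwv] using hw
    exact absurd (hmax _ (by simpa using hP)) (by simpa using hlt)
  calc m * s * d ≤ 2 * (m - I.card) * s * d := by gcongr; omega
    _ = 2 * ((m - I.card) * s * d) := by ring
    _ ≤ 2 * G.exIn (pathGraph (n + 1)) := by
      gcongr
      exact (Nat.mul_le_mul_right d hlower).trans hle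

end Constructions

end SimpleGraph

namespace SimpleGraph

open MeasureTheory ProbabilityTheory unitInterval

/-! ### Upper tail: union bound over sets of 2n vertices -/

section UpperTail

variable {V : Type*} (p : I)

/-- Upper tail bound for the number of edges among a given set of pairs. -/
lemma measureReal_lt_ncard_le [Finite V] (T : Finset (Sym2 V)) (hT : ∀ e ∈ T, ¬ e.IsDiag)
    {τ c : ℝ} (hτ : 0 ≤ τ) (hc : 0 ≤ c) (hμ : T.card * (p : ℝ) ≤ τ * Real.exp (-c)) :
    (binomialRandom V p).real {G | τ < ({e ∈ G.edgeSet | e ∈ T}.ncard : ℝ)} ≤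
      Real.exp (τ - c * τ) := by
  classical
  set s := ⌊τ⌋₊ + 1
  have hsτ : τ ≤ s := by simpa [s] using (Nat.lt_floor_add_one τ).le
  have hp0 : (0 : ℝ) ≤ p := p.2.1
  have hsub : {G : SimpleGraph V | τ < ({e ∈ G.edgeSet | e ∈ T}.ncard : ℝ)} ⊆
      ⋃ S ∈ T.powersetCard s, {G | ∀ e ∈ S, e ∈ G.edgeSet} := by
    intro G hG
    have h1 : s ≤ (T.filter fun e => e ∈ G.edgeSet).card := by
      have : {e ∈ G.edgeSet | e ∈ T} = (T.filter fun e => e ∈ G.edgeSet : Finset (Sym2 V)) := by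
        ext e; simp [and_comm]
      rw [Set.mem_ofPred_eq, this, Set.ncard_coe_finset] at hG
      exact Nat.succ_le_of_lt ((Nat.floor_lt hτ).2 hG)
    obtain ⟨S, hS, hcard⟩ := Finset.exists_subset_card_eq h1
    simp only [Set.mem_iUnion]
    refine ⟨S, Finset.mem_powersetCard.2 ⟨hS.trans (Finset.filter_subset _ _), hcard⟩, ?_⟩
    exact fun e he => (Finset.mem_filter.1 (hS he)).2
  calc _ ≤ (binomialRandom V p).real (⋃ S ∈ T.powersetCard s, {G | ∀ e ∈ S, e ∈ G.edgeSet}) :=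
        measureReal_mono hsub (measure_ne_top _ _)
    _ ≤ ∑ S ∈ T.powersetCard s, (binomialRandom V p).real {G | ∀ e ∈ S, e ∈ G.edgeSet} :=
        measureReal_biUnion_finset_le _ _
    _ = ∑ S ∈ T.powersetCard s, (p : ℝ) ^ s := by
        refine Finset.sum_congr rfl fun S hS => ?_
        obtain ⟨h1, h2⟩ := Finset.mem_powersetCard.1 hS
        rw [measureReal_subset_edgeSet p S fun e he => hT e (h1 he), h2]
    _ = (T.card.choose s : ℝ) * (p : ℝ) ^ s := by simp
    _ ≤ (T.card : ℝ) ^ s / s.factorial * (p : ℝ) ^ s := by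
        gcongr; exact Nat.choose_le_pow_div _ _
    _ = (T.card * (p : ℝ)) ^ s / s.factorial := by rw [mul_pow]; ring
    _ ≤ (τ * Real.exp (-c)) ^ s / s.factorial := by gcongr
    _ = τ ^ s / s.factorial * Real.exp (-c) ^ s := by rw [mul_pow]; ring
    _ ≤ Real.exp τ * Real.exp (-c * τ) := by
        gcongr
        · exact Real.pow_div_factorial_le_exp τ hτ s
        · rw [← Real.exp_nat_mul, Real.exp_le_exp]
          nlinarith
    _ = _ := by rw [← Real.exp_add]; ring_nf

variable [Fintype V]

lemma choose_le_exp {N k : ℕ} (hk : 0 < k) (hN : 0 < N) :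
    (N.choose k : ℝ) ≤ Real.exp (k * (Real.log (N / k) + 1)) := by
  have hk' : (0 : ℝ) < k := by exact_mod_cast hk
  have hN' : (0 : ℝ) < N := by exact_mod_cast hN
  calc (N.choose k : ℝ) ≤ (N : ℝ) ^ k / k.factorial := Nat.choose_le_pow_div _ _
    _ = ((N : ℝ) / k) ^ k * ((k : ℝ) ^ k / k.factorial) := by
        rw [div_pow]; field_simp
    _ ≤ ((N : ℝ) / k) ^ k * Real.exp k := by
        gcongr; exact Real.pow_div_factorial_le_exp _ hk'.le k
    _ = _ := by
        rw [mul_add, mul_one, Real.exp_add, Real.exp_nat_mul, Real.exp_log (by positivity)]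

lemma measureReal_exists_lt_ncard_le {n : ℕ} (hn : 0 < n) (hV : 2 * n ≤ Fintype.card V)
    {τ c : ℝ} (hτ : 0 ≤ τ) (hc : 0 ≤ c) (hμ : 2 * (n : ℝ) ^ 2 * p ≤ τ * Real.exp (-c)) :
    (binomialRandom V p).real {G | ∃ A : Finset V, A.card ≤ 2 * n ∧
      τ < ({e ∈ G.edgeSet | ∀ x ∈ e, x ∈ A}.ncard : ℝ)} ≤
      Real.exp (2 * n * (Real.log (Fintype.card V / (2 * n)) + 1) + (τ - c * τ)) := by
  classical
  have hp0 : (0 : ℝ) ≤ p := p.2.1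
  let T : Finset V → Finset (Sym2 V) := fun A => A.offDiag.image fun z => s(z.1, z.2)
  have hsub : {G : SimpleGraph V | ∃ A : Finset V, A.card ≤ 2 * n ∧
      τ < ({e ∈ G.edgeSet | ∀ x ∈ e, x ∈ A}.ncard : ℝ)} ⊆
      ⋃ A ∈ (Finset.univ : Finset V).powersetCard (2 * n),
        {G | τ < ({e ∈ G.edgeSet | e ∈ T A}.ncard : ℝ)} := by
    rintro G ⟨A, hA, hlt⟩
    -- Enlarging `A` only adds edges, so the union runs over sets of size exactly 2 * n.
    obtain ⟨B, hAB, -, hB⟩ := Finset.exists_subsuperset_card_eq (Finset.subset_univ A) hA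
      (by simpa using hV)
    simp only [Set.mem_iUnion]
    refine ⟨B, by simp [hB], hlt.trans_le ?_⟩
    norm_cast
    refine Set.ncard_le_ncard ?_ (Set.toFinite _)
    rintro e ⟨he, heA⟩
    refine ⟨he, ?_⟩
    induction e with | _ x y =>
    simp only [T, Finset.mem_image, Finset.mem_offDiag]
    exact ⟨(x, y), ⟨hAB (heA x (by simp)), hAB (heA y (by simp)), (G.ne_of_adj he)⟩, rfl⟩
  calc _ ≤ _ := measureReal_mono hsub (measure_ne_top _ _)
    _ ≤ ∑ A ∈ (Finset.univ : Finset V).powersetCard (2 * n), (binomialRandom V p).real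
        {G | τ < ({e ∈ G.edgeSet | e ∈ T A}.ncard : ℝ)} := measureReal_biUnion_finset_le _ _
    _ ≤ ∑ A ∈ (Finset.univ : Finset V).powersetCard (2 * n), Real.exp (τ - c * τ) := by
        refine Finset.sum_le_sum fun A hA => ?_
        refine measureReal_lt_ncard_le p (T A) ?_ hτ hc (le_trans ?_ hμ)
        · intro e he
          simp only [T, Finset.mem_image, Finset.mem_offDiag] at he
          obtain ⟨z, hz, rfl⟩ := he
          simpa using hz.2.2
        · gcongr
          have h1 : (T A).card = (2 * n).choose 2 := by
            rw [← (Finset.mem_powersetCard.1 hA).2]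
            exact Sym2.card_image_offDiag A
          rw [h1, Nat.cast_choose_two]
          push_cast
          have : (0 : ℝ) ≤ n := by positivity
          nlinarith
    _ = ((Fintype.card V).choose (2 * n) : ℝ) * Real.exp (τ - c * τ) := by simp
    _ ≤ Real.exp ((2 * n : ℕ) * (Real.log (Fintype.card V / (2 * n : ℕ)) + 1)) *
        Real.exp (τ - c * τ) := by
        gcongr
        exact choose_le_exp (by omega) (by omega)
    _ = _ := by rw [← Real.exp_add]; push_cast; rfl

/-- Upper tail bound for `ex(G, P_{n+1})`. -/
lemma measureReal_lt_exIn_le {n : ℕ} (hn : 0 < n) (hV : 2 * n ≤ Fintype.card V)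
    {τ c X : ℝ} (hτ : 0 ≤ τ) (hc : 0 ≤ c) (hμ : 2 * (n : ℝ) ^ 2 * p ≤ τ * Real.exp (-c))
    (hX : ((Fintype.card V : ℝ) / n + 1) * τ ≤ X) :
    (binomialRandom V p).real {G | X < (G.exIn (pathGraph (n + 1)) : ℝ)} ≤
      Real.exp (2 * n * (Real.log (Fintype.card V / (2 * n)) + 1) + (τ - c * τ)) := by
  refine (measureReal_mono ?_).trans (measureReal_exists_lt_ncard_le p hn hV hτ hc hμ)
  intro G hG
  by_contra hcon
  simp only [Set.mem_ofPred_eq, not_exists, not_and, not_lt] at hcon hG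
  have h1 := exIn_pathGraph_le (G := G) (t := ⌊τ⌋₊) hn fun A hA => Nat.le_floor (hcon A hA)
  have h2 : (G.exIn (pathGraph (n + 1)) : ℝ) ≤ (Fintype.card V / n + 1) * τ := by
    calc (G.exIn (pathGraph (n + 1)) : ℝ) ≤ ((Fintype.card V / n + 1 : ℕ) : ℝ) * (⌊τ⌋₊ : ℝ) := by
          exact_mod_cast h1
      _ ≤ _ := by
          push_cast
          gcongr
          · exact Nat.cast_div_le
          · exact Nat.floor_le hτ
  linarith

/-- The crude bound by the number of all edges, which is enough when N is a bounded multiple of n.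
-/
lemma measureReal_lt_exIn_le_of_card {W : Type*} (F : SimpleGraph W) {τ c : ℝ} (hτ : 0 ≤ τ)
    (hc : 0 ≤ c) (hμ : (Fintype.card V : ℝ) ^ 2 / 2 * p ≤ τ * Real.exp (-c)) :
    (binomialRandom V p).real {G | τ < (G.exIn F : ℝ)} ≤ Real.exp (τ - c * τ) := by
  classical
  have hp0 : (0 : ℝ) ≤ p := p.2.1
  set T : Finset (Sym2 V) := Finset.univ.offDiag.image fun z : V × V => s(z.1, z.2)
  refine (measureReal_mono ?_).trans (measureReal_lt_ncard_le p T ?_ hτ hc (le_trans ?_ hμ))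
  · intro G hG
    refine lt_of_lt_of_le (show τ < (G.exIn F : ℝ) from hG) ?_
    norm_cast
    refine (exIn_le_ncard_edgeSet G F).trans (Set.ncard_le_ncard ?_ (Set.toFinite _))
    intro e he
    refine ⟨he, ?_⟩
    induction e with | _ x y =>
    simp only [T, Finset.mem_image, Finset.mem_offDiag]
    exact ⟨(x, y), ⟨by simp, by simp, G.ne_of_adj he⟩, rfl⟩
  · intro e he
    simp only [T, Finset.mem_image, Finset.mem_offDiag] at he
    obtain ⟨z, hz, rfl⟩ := he
    simpa using hz.2.2
  · gcongr
    have h1 : T.card = (Fintype.card V).choose 2 := by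
      rw [← Finset.card_univ]
      exact Sym2.card_image_offDiag _
    rw [h1, Nat.cast_choose_two]
    have : (0 : ℝ) ≤ Fintype.card V := by positivity
    nlinarith

end UpperTail

/-! ### Lower tail from disjoint cliques -/

section LowerTail

variable {N : ℕ} (p : I)

/-- The disjoint union of complete graphs on consecutive blocks of `n` vertices. -/
def blockGraph (N n : ℕ) : SimpleGraph (Fin N) where
  Adj x y := x ≠ y ∧ x.val / n = y.val / n
  symm := ⟨fun _ _ h => ⟨h.1.symm, h.2.symm⟩⟩
  loopless := ⟨fun _ h => h.1 rfl⟩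

lemma blockGraph_fiber_ncard_le {n : ℕ} (hn : 0 < n) (i : ℕ) :
    {x : Fin N | x.val / n = i}.ncard ≤ n := by
  have h : (Fin.val '' {x : Fin N | x.val / n = i}).ncard ≤ n := by
    have hsub : Fin.val '' {x : Fin N | x.val / n = i} ⊆
        (Finset.Ico (i * n) (i * n + n) : Finset ℕ) := by
      rintro _ ⟨x, hx, rfl⟩
      have h1 := (Nat.div_eq_iff hn).1 hx
      simp only [Finset.coe_Ico, Set.mem_Ico]
      omega
    refine (Set.ncard_le_ncard hsub (Finset.finite_toSet _)).trans ?_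
    rw [Set.ncard_coe_finset]
    simp
  rwa [Set.ncard_image_of_injective _ Fin.val_injective] at h

lemma inf_blockGraph_free {n : ℕ} (hn : 0 < n) (G : SimpleGraph (Fin N)) :
    (pathGraph (n + 1)).Free (G ⊓ blockGraph N n) := by
  refine pathGraph_free_of_fibers hn (fun x => some (x.val / n)) ?_ ?_
  · intro x y h
    exact ⟨congrArg some h.2.2, by simp⟩
  · intro i
    simpa using blockGraph_fiber_ncard_le hn i

/-- Vertices of complete blocks have degree at least n - 1, and fewer than n vertices lie in the
incomplete last block. -/
lemma card_edgeFinset_blockGraph {n : ℕ} [DecidableRel (blockGraph N n).Adj] (hn : 0 < n)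
    (hN : n ≤ N) : (N - n) * (n - 1) ≤ 2 * (blockGraph N n).edgeFinset.card := by
  rw [← sum_degrees_eq_twice_card_edges]
  set S : Finset (Fin N) := Finset.univ.filter fun x => x.val < N / n * n
  have hS : N - n ≤ S.card := by
    have h1 : N / n * n ≤ N := Nat.div_mul_le_self N n
    have h2 : S.card = N / n * n := by
      have : S = (Finset.univ.filter fun x : Fin N => x.val < N / n * n) := rfl
      rw [this, Fin.card_filter_val_lt]
      exact min_eq_right h1
    have := Nat.div_add_mod N n
    have := Nat.mod_lt N hn
    rw [h2, mul_comm]; omega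
  have hdeg : ∀ x ∈ S, n - 1 ≤ (blockGraph N n).degree x := by
    intro x hx
    have hx' : x.val < N / n * n := by simpa [S] using hx
    have hlt : x.val / n < N / n := (Nat.div_lt_iff_lt_mul hn).2 hx'
    have hle : x.val / n * n + n ≤ N := by
      calc x.val / n * n + n = (x.val / n + 1) * n := by ring
        _ ≤ N / n * n := Nat.mul_le_mul_right n hlt
        _ ≤ N := Nat.div_mul_le_self N n
    let g : Fin n ↪ Fin N := ⟨fun j => ⟨x.val / n * n + j, by omega⟩, by
      intro a b hab; simpa [Fin.ext_iff] using hab⟩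
    have hsub : (Finset.univ.map g).erase x ⊆ (blockGraph N n).neighborFinset x := by
      intro y hy
      obtain ⟨hyx, hy⟩ := Finset.mem_erase.1 hy
      obtain ⟨j, -, rfl⟩ := Finset.mem_map.1 hy
      rw [mem_neighborFinset]
      refine ⟨hyx.symm, ?_⟩
      change x.val / n = (x.val / n * n + j) / n
      rw [mul_comm, Nat.mul_add_div hn, Nat.div_eq_of_lt j.2, add_zero]
    rw [← card_neighborFinset_eq_degree]
    refine le_trans ?_ (Finset.card_le_card hsub)
    refine le_trans ?_ Finset.pred_card_le_card_erase
    simp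
  calc (N - n) * (n - 1) ≤ S.card * (n - 1) := by gcongr
    _ ≤ ∑ x ∈ S, (blockGraph N n).degree x := by
        rw [← smul_eq_mul]; exact Finset.card_nsmul_le_sum _ _ _ hdeg
    _ ≤ _ := Finset.sum_le_sum_of_subset (Finset.subset_univ _)

/-- `M` is the exact mean number of random edges inside the blocks. Only a lower bound for it is
known, which suffices by `div_sq_sub_le`. -/
lemma measureReal_exIn_le_of_blocks {n : ℕ} (hn : 0 < n) (hN : n ≤ N) {θ : ℝ}
    (hθ : θ < ((N : ℝ) - n) * (n - 1) / 2 * p) :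
    ∃ M : ℝ, ((N : ℝ) - n) * (n - 1) / 2 * p ≤ M ∧
    (binomialRandom (Fin N) p).real {G | (G.exIn (pathGraph (n + 1)) : ℝ) ≤ θ} ≤
      M / (M - θ) ^ 2 := by
  classical
  set B := (blockGraph N n).edgeFinset
  have hB : ((N : ℝ) - n) * (n - 1) / 2 ≤ B.card := by
    have h := card_edgeFinset_blockGraph hn hN
    have h' : (((N - n) * (n - 1) : ℕ) : ℝ) ≤ ((2 * B.card : ℕ) : ℝ) := by exact_mod_cast h
    push_cast [Nat.cast_sub hN, Nat.cast_sub (show 1 ≤ n from hn)] at h'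
    linarith
  have hM : ((N : ℝ) - n) * (n - 1) / 2 * p ≤ B.card * p :=
    mul_le_mul_of_nonneg_right hB p.2.1
  refine ⟨B.card * p, hM, ?_⟩
  refine (measureReal_mono ?_).trans (measureReal_card_le_of_determinedBy p B
    (fun e _ => determinedBy_mem e) (by intro a _ b _ hab; simpa using hab)
    (fun e he => measureReal_mem_edgeSet p
      (not_isDiag_of_mem_edgeSet _ (mem_edgeFinset.1 he))) (hθ.trans_le hM))
  intro G hG
  refine le_trans ?_ (show (G.exIn (pathGraph (n + 1)) : ℝ) ≤ θ from hG)
  norm_cast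
  refine le_trans (le_of_eq ?_) (ncard_edgeSet_le_exIn inf_le_left (inf_blockGraph_free hn G))
  rw [← Set.ncard_coe_finset, edgeSet_inf]
  congr 1
  ext e
  simp [B, and_comm]

end LowerTail

end SimpleGraph

namespace SimpleGraph

open MeasureTheory ProbabilityTheory unitInterval

/-! ### Lower tail from star forests and from cells -/

variable {V : Type*} (p : I)

lemma measureReal_exIn_le_of_stars [Fintype V] {n : ℕ} (hn : 3 ≤ n) (R : Finset V) {c : ℕ}
    (hc : R.card + c = Fintype.card V) {θ : ℝ}
    (hθ : θ < R.card * (1 - (1 - p : ℝ) ^ c)) :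
    (binomialRandom V p).real {G | (G.exIn (pathGraph (n + 1)) : ℝ) ≤ θ} ≤
      R.card * (1 - (1 - p : ℝ) ^ c) / (R.card * (1 - (1 - p : ℝ) ^ c) - θ) ^ 2 := by
  classical
  -- For distinct `v` in `R` these sets of pairs are disjoint, so the events of having a neighbour
  -- outside `R` are independent.
  let T : V → Finset (Sym2 V) := fun v => Rᶜ.image fun w => s(v, w)
  have hdiag : ∀ v ∈ R, ∀ e ∈ T v, ¬ e.IsDiag := by
    intro v hv e he
    obtain ⟨w, hw, rfl⟩ := Finset.mem_image.1 he
    rw [Sym2.mk_isDiag_iff]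
    rintro rfl
    exact Finset.mem_compl.1 hw hv
  have hcard : ∀ v, (T v).card = c := by
    intro v
    rw [Finset.card_image_of_injective _ fun a b h => Sym2.congr_right.1 h,
      Finset.card_compl]
    omega
  have hdisj : (R : Set V).PairwiseDisjoint fun v => (T v : Set (Sym2 V)) := by
    intro v hv v' hv' hvv'
    rw [Function.onFun, Set.disjoint_left]
    intro e he he'
    obtain ⟨w, hw, rfl⟩ := Finset.mem_image.1 he
    obtain ⟨w', hw', h⟩ := Finset.mem_image.1 he'
    rcases Sym2.eq_iff.1 h with ⟨h, -⟩ | ⟨h, -⟩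
    · exact hvv' h.symm
    · exact Finset.mem_compl.1 hw (h ▸ hv')
  refine (measureReal_mono ?_).trans (measureReal_card_le_of_determinedBy p R
    (fun v _ => determinedBy_exists_mem (T v)) hdisj
    (fun v hv => by rw [measureReal_exists_mem_edgeSet p (T v) (hdiag v hv), hcard]) hθ)
  intro G hG
  refine le_trans ?_ (show (G.exIn (pathGraph (n + 1)) : ℝ) ≤ θ from hG)
  norm_cast
  refine le_trans (Finset.card_le_card ?_) (card_filter_exists_adj_le_exIn G hn R)
  intro v hv
  simp only [Finset.mem_filter, Set.mem_ofPred_eq] at hv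
  obtain ⟨hv, e, he, heG⟩ := hv
  obtain ⟨w, hw, rfl⟩ := Finset.mem_image.1 he
  exact Finset.mem_filter.2 ⟨hv, w, Finset.mem_compl.1 hw, heG⟩

section Cells

variable {m d k r : ℕ}

open scoped Classical in
/-- The pairs joining the outer vertex `v` to the `j`-th group of the `i`-th cell. -/
noncomputable def cellPairs (φ : (Fin m × Fin d × Fin k) ⊕ Fin r ↪ V)
    (z : Fin m × Fin r) (j : Fin d) : Finset (Sym2 V) :=
  Finset.univ.image fun l => s(φ (.inl (z.1, j, l)), φ (.inr z.2))

/-- This disjointness gives both independences: between the groups of one cell, and between the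
goodness events of different pairs of a cell and an outer vertex. -/
lemma eq_of_mem_cellPairs {φ : (Fin m × Fin d × Fin k) ⊕ Fin r ↪ V}
    {z z' : Fin m × Fin r} {j j' : Fin d} {e : Sym2 V}
    (h : e ∈ cellPairs φ z j) (h' : e ∈ cellPairs φ z' j') : z = z' ∧ j = j' := by
  simp only [cellPairs, Finset.mem_image, Finset.mem_univ, true_and] at h h'
  obtain ⟨l, rfl⟩ := h
  obtain ⟨l', h'⟩ := h'
  simp only [Sym2.eq_iff, φ.injective.eq_iff, Sum.inr.injEq, Sum.inl.injEq, reduceCtorEq,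
    false_and, or_false, Prod.mk.injEq] at h'
  exact ⟨Prod.ext h'.1.1.symm h'.2.symm, h'.1.2.1.symm⟩

lemma setOf_isGood_eq (φ : (Fin m × Fin d × Fin k) ⊕ Fin r ↪ V)
    (z : Fin m × Fin r) : {G : SimpleGraph V | IsGood G φ z.1 z.2} =
    ⋂ j ∈ (Finset.univ : Finset (Fin d)), {G | ∃ e ∈ cellPairs φ z j, e ∈ G.edgeSet} := by
  ext G
  simp [IsGood, cellPairs]

lemma determinedBy_isGood (φ : (Fin m × Fin d × Fin k) ⊕ Fin r ↪ V)
    (z : Fin m × Fin r) :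
    DeterminedBy {G : SimpleGraph V | IsGood G φ z.1 z.2}
      (⋃ j ∈ (Finset.univ : Finset (Fin d)), (cellPairs φ z j : Set (Sym2 V))) := by
  rw [setOf_isGood_eq]
  exact DeterminedBy.iInter (B := ((Finset.univ : Finset (Fin d)) : Set (Fin d)))
    fun j _ => determinedBy_exists_mem (cellPairs φ z j)

lemma measureReal_isGood [Fintype V]
    (φ : (Fin m × Fin d × Fin k) ⊕ Fin r ↪ V)
    (z : Fin m × Fin r) :
    (binomialRandom V p).real {G | IsGood G φ z.1 z.2} = (1 - (1 - p : ℝ) ^ k) ^ d := by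
  classical
  rw [setOf_isGood_eq, measureReal_biInter_of_determinedBy p Finset.univ
    (fun j _ => determinedBy_exists_mem (cellPairs φ z j))]
  · rw [Finset.prod_congr rfl fun j _ => measureReal_exists_mem_edgeSet p (cellPairs φ z j) ?_]
    · have hcard : ∀ j, (cellPairs φ z j).card = k := fun j => by
        rw [cellPairs, Finset.card_image_of_injective _ fun a b h => by simpa using h]
        simp
      simp [hcard]
    · intro e he
      simp only [cellPairs, Finset.mem_image, Finset.mem_univ, true_and] at he
      obtain ⟨l, rfl⟩ := he
      simp
  · intro j _ j' _ hj
    rw [Function.onFun, Set.disjoint_left]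
    exact fun e he he' => hj (eq_of_mem_cellPairs he he').2

lemma measureReal_forall_not_isGood [Fintype V]
    (φ : (Fin m × Fin d × Fin k) ⊕ Fin r ↪ V)
    (J : Finset (Fin m)) (U : Finset (Fin r)) :
    (binomialRandom V p).real {G | ∀ i ∈ J, ∀ v ∈ U, ¬ IsGood G φ i v} =
      (1 - (1 - (1 - p : ℝ) ^ k) ^ d) ^ (J.card * U.card) := by
  have h := measureReal_biInter_of_determinedBy p (J ×ˢ U)
    (fun z _ => (determinedBy_isGood φ z).compl) (by
      intro z _ z' _ hz
      rw [Function.onFun, Set.disjoint_left]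
      intro e he he'
      simp only [Finset.mem_univ, Set.iUnion_true, Set.mem_iUnion] at he he'
      obtain ⟨j, hj⟩ := he
      obtain ⟨j', hj'⟩ := he'
      exact hz (eq_of_mem_cellPairs hj hj').1)
  have h2 : ∀ z ∈ J ×ˢ U, (binomialRandom V p).real {G | IsGood G φ z.1 z.2}ᶜ =
      1 - (1 - (1 - p : ℝ) ^ k) ^ d := fun z _ => by
    rw [probReal_compl_eq_one_sub MeasurableSet.of_discrete, measureReal_isGood]
  rw [Finset.prod_congr rfl h2, Finset.prod_const, Finset.card_product] at h
  rw [← h]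
  congr 1
  ext G
  simp only [Set.mem_ofPred_eq, Set.mem_iInter, Finset.mem_product, Set.mem_compl_iff, Prod.forall]
  tauto

/-- Lower tail bound for `ex(G, P_{n+1})` from dense pieces made of a cell and outer vertices. -/
lemma measureReal_exIn_lt_of_cells [Fintype V]
    (φ : (Fin m × Fin d × Fin k) ⊕ Fin r ↪ V)
    {n s : ℕ} (hn : 0 < n) (hdk : d * k + s ≤ n)
    {q u : ℝ} (hq0 : 0 ≤ q) (hq : q ≤ (1 - (1 - p : ℝ) ^ k) ^ d) (hu0 : 0 ≤ u)
    (hu : u + m * s ≤ r) :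
    (binomialRandom V p).real {G | 2 * (G.exIn (pathGraph (n + 1)) : ℝ) < m * s * d} ≤
      2 ^ (m + r) * Real.exp (-(q * (m / 2 * u))) := by
  classical
  -- Failure is witnessed by a pair of large sets without a good pair. There are at most 2^(m+r)
  -- such pairs of sets, and for each the probability is at most exp(-q |I| |U|) with |I| ≥ m/2 and
  -- |U| ≥ u.
  set Q : Finset (Finset (Fin m) × Finset (Fin r)) :=
    Finset.univ.filter fun z => m ≤ 2 * z.1.card ∧ r ≤ z.2.card + m * s
  have hsub : {G : SimpleGraph V | 2 * (G.exIn (pathGraph (n + 1)) : ℝ) < m * s * d} ⊆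
      ⋃ z ∈ Q, {G | ∀ i ∈ z.1, ∀ v ∈ z.2, ¬ IsGood G φ i v} := by
    intro G hG
    by_contra hcon
    simp only [Set.mem_iUnion, not_exists] at hcon
    refine absurd (show 2 * (G.exIn (pathGraph (n + 1)) : ℝ) < m * s * d from hG) (not_lt.2 ?_)
    have := mul_le_two_mul_exIn G hn φ hdk fun J U hJ hU => by
      have := hcon (J, U) (by simp [Q, hJ, hU])
      simpa using this
    exact_mod_cast this
  calc _ ≤ _ := measureReal_mono hsub (measure_ne_top _ _)
    _ ≤ ∑ z ∈ Q, (binomialRandom V p).real {G | ∀ i ∈ z.1, ∀ v ∈ z.2, ¬ IsGood G φ i v} :=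
        measureReal_biUnion_finset_le _ _
    _ ≤ ∑ z ∈ Q, Real.exp (-(q * (m / 2 * u))) := by
        refine Finset.sum_le_sum fun z hz => ?_
        obtain ⟨h1, h2⟩ := (Finset.mem_filter.1 hz).2
        have h1' : (m : ℝ) ≤ 2 * z.1.card := by exact_mod_cast h1
        have h2' : (r : ℝ) ≤ z.2.card + m * s := by exact_mod_cast h2
        rw [measureReal_forall_not_isGood]
        have hp0 : (0 : ℝ) ≤ 1 - p := sub_nonneg.2 p.2.2
        have hp1 : (1 - p : ℝ) ≤ 1 := by linarith [p.2.1]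
        have hle1 : (1 - (1 - p : ℝ) ^ k) ^ d ≤ 1 :=
          pow_le_one₀ (sub_nonneg.2 (pow_le_one₀ hp0 hp1)) (by linarith [pow_nonneg hp0 k])
        calc (1 - (1 - (1 - p : ℝ) ^ k) ^ d) ^ (z.1.card * z.2.card)
            ≤ Real.exp (-q) ^ (z.1.card * z.2.card) := by
              refine pow_le_pow_left₀ (by linarith) ?_ _
              linarith [Real.add_one_le_exp (-q)]
          _ = Real.exp (-(q * (z.1.card * z.2.card))) := by
              rw [← Real.exp_nat_mul]; push_cast; ring_nf
          _ ≤ _ := by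
              gcongr
              · linarith
              · linarith
    _ = Q.card * Real.exp (-(q * (m / 2 * u))) := by simp
    _ ≤ _ := by
        gcongr
        have : Q.card ≤ 2 ^ (m + r) := by
          refine (Finset.card_le_univ Q).trans (le_of_eq ?_)
          simp [pow_add]
        exact_mod_cast this

end Cells

end SimpleGraph

namespace SimpleGraph

open MeasureTheory ProbabilityTheory unitInterval

/-! ### Choice of parameters and numerical estimates -/

section Estimates

variable {n N : ℕ} {p : I}

lemma one_le_log_div (hn : 0 < n) (hN : 3 * (n : ℝ) ≤ N) : 1 ≤ Real.log ((N : ℝ) / n) := by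
  have hn' : (0 : ℝ) < n := by exact_mod_cast hn
  have hN' : (0 : ℝ) < N := by linarith
  rw [Real.le_log_iff_exp_le (by positivity)]
  calc Real.exp 1 ≤ 3 := by linarith [Real.exp_one_lt_d9]
    _ ≤ N / n := by rwa [le_div_iff₀ hn']

lemma log_div_two_mul (hn : 0 < n) (hN : 0 < N) :
    Real.log ((N : ℝ) / (2 * n)) = Real.log ((N : ℝ) / n) - Real.log 2 := by
  have hn' : (n : ℝ) ≠ 0 := by positivity
  have hN' : (N : ℝ) ≠ 0 := by positivity
  rw [← Real.log_div (by positivity) (by norm_num)]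
  congr 1
  field_simp

/-- Upper tail bound in the dense range. -/
lemma measureReal_lt_exIn_le_exp_of_dense (hn : 0 < n) (hN : 3 * (n : ℝ) ≤ N)
    (hp : Real.log ((N : ℝ) / n) / (6 * n) ≤ p) :
    (binomialRandom (Fin N) p).real
      {G | 18 * ((p : ℝ) * n * N) < (G.exIn (pathGraph (n + 1)) : ℝ)} ≤ Real.exp (-n) := by
  have hn' : (0 : ℝ) < n := by exact_mod_cast hn
  have hN' : (0 : ℝ) < N := by linarith
  have hL1 := one_le_log_div hn hN
  have hlog := log_div_two_mul hn (by exact_mod_cast hN')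
  have hp' : Real.log ((N : ℝ) / n) ≤ 6 * ((p : ℝ) * n) := by
    rw [div_le_iff₀ (by positivity)] at hp; linarith
  have hlog2 := Real.log_two_gt_d9
  have hp0 : (0 : ℝ) ≤ p := p.2.1
  -- With τ = 16pn², the block bound is 16pn(N + n), which is at most 18pnN once N ≥ 8n. Below that,
  -- the expected number of all edges is at most pN²/2 ≤ 4pnN.
  rcases lt_or_ge (N : ℝ) (8 * n) with h8 | h8
  · have hc : Real.log 4 = 2 * Real.log 2 := by
      rw [show (4 : ℝ) = 2 ^ 2 by norm_num, Real.log_pow]; norm_num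
    refine (measureReal_lt_exIn_le_of_card p _ (τ := 18 * ((p : ℝ) * n * N)) (c := Real.log 4)
      (by positivity) (Real.log_nonneg (by norm_num)) ?_).trans (Real.exp_le_exp.2 ?_)
    · rw [Real.exp_neg, Real.exp_log (by norm_num)]
      simp only [Fintype.card_fin]
      have : 0 ≤ (p : ℝ) * N := by positivity
      nlinarith
    · have h1 : 3 * (N : ℝ) ≤ 18 * ((p : ℝ) * n * N) := by nlinarith
      rw [hc]
      nlinarith
  · have hL8 : 3 * Real.log 2 ≤ Real.log ((N : ℝ) / n) := by
      rw [show 3 * Real.log 2 = Real.log (2 ^ 3) by rw [Real.log_pow]; norm_num]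
      refine Real.log_le_log (by norm_num) ?_
      rw [le_div_iff₀ hn']; linarith
    have hc : Real.log 8 = 3 * Real.log 2 := by
      rw [show (8 : ℝ) = 2 ^ 3 by norm_num, Real.log_pow]; norm_num
    refine (measureReal_lt_exIn_le p hn (τ := 16 * p * n ^ 2) (c := Real.log 8) ?_
      (by positivity) (Real.log_nonneg (by norm_num)) ?_ ?_).trans (Real.exp_le_exp.2 ?_)
    · have : (2 * n : ℝ) ≤ N := by linarith
      simpa using (by exact_mod_cast this : 2 * n ≤ N)
    · rw [Real.exp_neg, Real.exp_log (by norm_num)]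
      linarith
    · simp only [Fintype.card_fin]
      have : ((N : ℝ) / n + 1) * (16 * p * n ^ 2) = (p * n) * (16 * (N + n)) := by
        field_simp
      rw [this]
      have : 0 ≤ (p : ℝ) * n := by positivity
      nlinarith
    · simp only [Fintype.card_fin]
      rw [hlog, hc]
      set L := Real.log ((N : ℝ) / n)
      have h1 : 16 / 6 * L * n ≤ 16 * p * n ^ 2 := by nlinarith
      have h2 : 16 * (p : ℝ) * n ^ 2 - 3 * Real.log 2 * (16 * p * n ^ 2) ≤
          (16 / 6 * L * n) * (1 - 3 * Real.log 2) := by nlinarith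
      have h3 : (16 / 6 * L * n) * (1 - 3 * Real.log 2) ≤ (16 / 6 * L * n) * (-1.07) := by
        refine mul_le_mul_of_nonneg_left (by linarith) (by positivity)
      have h4 : 2 * (n : ℝ) * (L - Real.log 2 + 1) ≤ 2 * n * (L + 0.31) := by
        refine mul_le_mul_of_nonneg_left (by linarith) (by positivity)
      have h5 : 2 * (n : ℝ) ≤ L * n := by nlinarith
      nlinarith

/-- Upper tail bound in the sparse range. -/
lemma measureReal_lt_exIn_le_exp_of_sparse (hn : 0 < n) (hN : 3 * (n : ℝ) ≤ N) {ω : ℝ}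
    (hω : 6 ≤ ω) (hL : Real.log ((N : ℝ) / n) = ω * (n * p)) :
    (binomialRandom (Fin N) p).real
      {G | 8 * (ω / Real.log ω) * ((p : ℝ) * n * N) < (G.exIn (pathGraph (n + 1)) : ℝ)} ≤
      Real.exp (-n) := by
  have hn' : (0 : ℝ) < n := by exact_mod_cast hn
  have hN' : (0 : ℝ) < N := by linarith
  have hL1 := one_le_log_div hn hN
  have hlog := log_div_two_mul hn (by exact_mod_cast hN')
  have hlog2 := Real.log_two_gt_d9
  set L := Real.log ((N : ℝ) / n)
  set x := Real.log ω with hx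
  have hx0 : 0 < x := Real.log_pos (by linarith)
  -- This is log x ≤ x / e.
  have hlogx : Real.log x ≤ 0.37 * x := by
    have h1 := Real.log_le_sub_one_of_pos (show 0 < x / Real.exp 1 by positivity)
    rw [Real.log_div hx0.ne' (Real.exp_pos 1).ne', Real.log_exp] at h1
    have h2 : x / Real.exp 1 ≤ 0.37 * x := by
      rw [div_le_iff₀ (Real.exp_pos 1)]
      nlinarith [Real.exp_one_gt_d9]
    linarith
  have hlog3 : 1 ≤ Real.log 3 := by linarith [Real.log_three_gt_d9]
  have hc : Real.log (3 * ω / x) = Real.log 3 + x - Real.log x := by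
    rw [Real.log_div (by positivity) hx0.ne', Real.log_mul (by norm_num) (by positivity)]
  have hc' : 1 + 0.63 * x ≤ Real.log (3 * ω / x) := by rw [hc]; linarith
  have hL0 : 0 < L := by linarith
  -- Since L = ωnp, this `c` gives τ e^(-c) = 2n²p exactly. As n ≤ N/3, the block factor turns 6
  -- into 8. The exponent gains 3.78nL, against about 2nL from the choice of the 2n-set.
  refine (measureReal_lt_exIn_le p hn (τ := 6 * n * L / x) (c := Real.log (3 * ω / x)) ?_
      (by positivity) (by linarith) ?_ ?_).trans (Real.exp_le_exp.2 ?_)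
  · have : (2 * n : ℝ) ≤ N := by linarith
    simpa using (by exact_mod_cast this : 2 * n ≤ N)
  · rw [Real.exp_neg, Real.exp_log (by positivity), hL]
    refine le_of_eq ?_
    field_simp
    ring
  · simp only [Fintype.card_fin]
    have h1 : ((N : ℝ) / n + 1) * (6 * n * L / x) = 6 * (N + n) * L / x := by
      field_simp
    have h2 : 8 * (ω / x) * (p * n * N) = 8 * N * L / x := by
      rw [hL]; field_simp
    rw [h1, h2]
    gcongr ?_ * L / x
    linarith
  · simp only [Fintype.card_fin]
    rw [hlog]
    have h1 : 6 * n * L / x - Real.log (3 * ω / x) * (6 * n * L / x) ≤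
        6 * n * L / x * (-(0.63 * x)) := by
      have : 0 ≤ 6 * n * L / x := by positivity
      nlinarith
    have h2 : 6 * n * L / x * (-(0.63 * x)) = - (3.78 * (n * L)) := by
      field_simp; ring
    have h4 : 2 * (n : ℝ) * (L - Real.log 2 + 1) ≤ 2 * n * (L + 0.31) := by
      refine mul_le_mul_of_nonneg_left (by linarith) (by positivity)
    have h5 : (n : ℝ) ≤ n * L := by nlinarith
    nlinarith

/-- The gap M - θ is at least εM, and the resulting Chebyshev bound 1 / (ε²M) decreases in the mean
`M`. -/
lemma div_sq_sub_le {M θ ε B : ℝ} (hε : 0 < ε) (hB : 0 < B) (hM : B ≤ M)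
    (hθ : θ ≤ (1 - ε) * M) : M / (M - θ) ^ 2 ≤ 1 / (ε ^ 2 * B) := by
  have hM0 : 0 < M := hB.trans_le hM
  have h1 : ε * M ≤ M - θ := by linarith
  have h2 : 0 < ε * M := by positivity
  calc M / (M - θ) ^ 2 ≤ M / (ε * M) ^ 2 := by gcongr
    _ = 1 / (ε ^ 2 * M) := by field_simp
    _ ≤ _ := by gcongr

/-- Lower tail bound in the dense range. -/
lemma measureReal_exIn_lt_le_of_dense (hn : 100 ≤ n) (hN : 3 * (n : ℝ) ≤ N)
    (hp : Real.log ((N : ℝ) / n) / (6 * n) ≤ p) :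
    (binomialRandom (Fin N) p).real
      {G | (G.exIn (pathGraph (n + 1)) : ℝ) < 1 / 4 * ((p : ℝ) * n * N)} ≤ 1000 / n := by
  have hn100 : (100 : ℝ) ≤ n := by exact_mod_cast hn
  have hn' : (0 : ℝ) < n := by linarith
  have hN' : (0 : ℝ) < N := by linarith
  have hL1 := one_le_log_div (by omega) hN
  have hp' : Real.log ((N : ℝ) / n) ≤ 6 * ((p : ℝ) * n) := by
    rw [div_le_iff₀ (by positivity)] at hp; linarith
  have hpn : 1 / 6 ≤ (p : ℝ) * n := by linarith
  have hY : (n : ℝ) / 2 ≤ p * n * N := by nlinarith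
  have hcount : 0.33 * ((n : ℝ) * N) ≤ ((N : ℝ) - n) * (n - 1) / 2 := by
    nlinarith [mul_nonneg (show (0 : ℝ) ≤ N - 3 * n by linarith)
      (show (0 : ℝ) ≤ n - 100 by linarith)]
  have hM0 : 0.33 * ((p : ℝ) * n * N) ≤ ((N : ℝ) - n) * (n - 1) / 2 * p := by
    nlinarith [mul_le_mul_of_nonneg_right hcount p.2.1]
  obtain ⟨M, hM, hle⟩ := measureReal_exIn_le_of_blocks (N := N) p (n := n) (by omega)
    (by exact_mod_cast (by linarith : (n : ℝ) ≤ N)) (θ := 1 / 4 * ((p : ℝ) * n * N))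
    (by linarith)
  refine (measureReal_mono (Set.ofPred_subset_ofPred.2 fun G hG => le_of_lt hG)
    (measure_ne_top _ _)).trans (hle.trans ?_)
  refine (div_sq_sub_le (ε := 0.24) (B := 0.33 * (n / 2)) (by norm_num) (by positivity)
    (by linarith) (by linarith)).trans ?_
  rw [div_le_div_iff₀ (by positivity) (by positivity)]
  linarith

/-- From (1 - x)^k (1 + x)^k ≤ 1 and Bernoulli's inequality, (1 - x)^k ≤ 1 / (1 + kx). -/
lemma div_one_add_le_one_sub_pow {x : ℝ} (hx0 : 0 ≤ x) (hx1 : x ≤ 1) (k : ℕ) :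
    k * x / (1 + k * x) ≤ 1 - (1 - x) ^ k := by
  have h1 : 1 + k * x ≤ (1 + x) ^ k := one_add_mul_le_pow (by linarith) k
  have h2 : (1 - x) ^ k * (1 + x) ^ k ≤ 1 := by
    rw [← mul_pow]
    exact pow_le_one₀ (by nlinarith) (by nlinarith)
  have h3 : (0 : ℝ) ≤ (1 - x) ^ k := pow_nonneg (by linarith) k
  have h4 : (0 : ℝ) < 1 + k * x := by positivity
  rw [div_le_iff₀ h4]
  nlinarith [mul_le_mul_of_nonneg_left h1 h3]

/-- Take half of the vertices as possible leaves. Since p ≥ 1/N, each has a neighbour in the other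
half with probability bounded below. The constant 10/75 is what the case L ≤ 10 log ω requires. -/
lemma measureReal_exIn_lt_le_of_inv_le (hn : 100 ≤ n) (hN : 3 * (n : ℝ) ≤ N)
    (hp : (N : ℝ)⁻¹ ≤ p) : (binomialRandom (Fin N) p).real
      {G | (G.exIn (pathGraph (n + 1)) : ℝ) < 10 / 75 * N} ≤ 1000 / n := by
  have hn100 : (100 : ℝ) ≤ n := by exact_mod_cast hn
  have hn' : (0 : ℝ) < n := by linarith
  have hN' : (0 : ℝ) < N := by linarith
  set c := N / 2
  set R : Finset (Fin N) := Finset.univ.filter fun x => x.val < N - c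
  have hcN : c ≤ N := Nat.div_le_self _ _
  have hR : R.card = N - c := by
    have : R = Finset.univ.filter fun x : Fin N => x.val < N - c := rfl
    rw [this, Fin.card_filter_val_lt]
    exact min_eq_right (Nat.sub_le _ _)
  have hc2 : (2 * c : ℝ) ≤ N := by exact_mod_cast (by omega : 2 * c ≤ N)
  have hc1 : (N : ℝ) ≤ 2 * c + 1 := by exact_mod_cast (by omega : N ≤ 2 * c + 1)
  have hRr : (R.card : ℝ) = N - c := by rw [hR, Nat.cast_sub hcN]
  have hpc : 0.49 ≤ c * (p : ℝ) := by
    have h1 : (c : ℝ) * (N : ℝ)⁻¹ ≤ c * p := by gcongr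
    refine le_trans ?_ h1
    rw [← div_eq_mul_inv, le_div_iff₀ hN']
    linarith
  have hq : 0.32 ≤ 1 - (1 - p : ℝ) ^ c := by
    refine le_trans ?_ (div_one_add_le_one_sub_pow p.2.1 p.2.2 c)
    rw [le_div_iff₀ (by positivity)]
    linarith
  have hM : 0.16 * (N : ℝ) ≤ R.card * (1 - (1 - p : ℝ) ^ c) := by
    rw [hRr]
    nlinarith
  refine (measureReal_mono (Set.ofPred_subset_ofPred.2 fun G hG => le_of_lt hG)
    (measure_ne_top _ _)).trans ((measureReal_exIn_le_of_stars p (n := n) (by omega) R (c := c)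
      (by rw [hR]; simp; omega) (θ := 10 / 75 * N) (by linarith)).trans ?_)
  refine (div_sq_sub_le (ε := 0.16) (B := 0.16 * N) (by norm_num) (by positivity)
    hM (by linarith)).trans ?_
  rw [div_le_div_iff₀ (by positivity) (by positivity)]
  nlinarith

lemma mul_le_cast_div_two_mul (hn : 0 < n) (hN : 1000 * (n : ℝ) ≤ N) :
    0.499 * ((N : ℝ) / n) ≤ (N / (2 * n) : ℕ) := by
  have hn' : (0 : ℝ) < n := by exact_mod_cast hn
  have hm1 : (N : ℝ) / (2 * n) ≤ (N / (2 * n) : ℕ) + 1 := by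
    rw [div_le_iff₀ (by positivity)]
    have h : N ≤ (N / (2 * n) + 1) * (2 * n) := by
      rw [mul_comm]; exact (Nat.lt_mul_div_succ N (show 0 < 2 * n by omega)).le
    exact_mod_cast h
  have hNn : 1000 ≤ (N : ℝ) / n := by rwa [le_div_iff₀ hn']
  have : (N : ℝ) / (2 * n) = 0.5 * (N / n) := by field_simp; ring
  linarith

lemma measureReal_exIn_lt_le_exp_of_cells (hn : 100 ≤ n) (hN : 1000 * (n : ℝ) ≤ N) {d k : ℕ}
    (hdk : 2 * d * k ≤ n) {q t : ℝ} (hq0 : 0 ≤ q) (hq : q ≤ (1 - (1 - p : ℝ) ^ k) ^ d)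
    (hqm : 34 ≤ q * (N / (2 * n) : ℕ)) (ht : 0 ≤ t) (hd : t / 8 ≤ d) :
    (binomialRandom (Fin N) p).real
      {G | (G.exIn (pathGraph (n + 1)) : ℝ) < 1 / 75 * (t * N)} ≤ Real.exp (-n) := by
  have hn100 : (100 : ℝ) ≤ n := by exact_mod_cast hn
  have hn' : (0 : ℝ) < n := by linarith
  have hN' : (0 : ℝ) < N := by linarith
  have hm := mul_le_cast_div_two_mul (by omega) hN
  set m := N / (2 * n)
  set s := n / 2
  set r := N / 2
  have hmn : m * (2 * n) ≤ N := Nat.div_mul_le_self _ _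
  have hcards : m * (d * k) + r ≤ N := by
    have : m * (d * k) * 2 ≤ m * n := by
      calc m * (d * k) * 2 = m * (2 * d * k) := by ring
        _ ≤ m * n := Nat.mul_le_mul_left _ hdk
    have : m * n * 2 ≤ N := by linarith
    omega
  obtain ⟨φ⟩ : Nonempty ((Fin m × Fin d × Fin k) ⊕ Fin r ↪ Fin N) := by
    refine Function.Embedding.nonempty_of_card_le ?_
    simpa using hcards
  have hs1 : 0.495 * (n : ℝ) ≤ s := by
    have : (n : ℝ) ≤ 2 * s + 1 := by exact_mod_cast (by omega : n ≤ 2 * s + 1)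
    linarith
  have hms4 : 4 * (m * s) ≤ N := by
    have h2 : 2 * s ≤ n := by omega
    calc 4 * (m * s) = m * (2 * (2 * s)) := by ring
      _ ≤ m * (2 * n) := by gcongr
      _ ≤ N := hmn
  have hms : 4 * ((m : ℝ) * s) ≤ N := by exact_mod_cast hms4
  have hr : (N : ℝ) ≤ 2 * r + 1 := by exact_mod_cast (by omega : N ≤ 2 * r + 1)
  have hmr : m + r ≤ N := by
    have : m * 2 ≤ m * (2 * n) := Nat.mul_le_mul_left _ (by omega)
    omega
  have hmain := measureReal_exIn_lt_of_cells p φ (n := n) (s := s) (by omega)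
    (by
      have : 2 * (d * k) ≤ n := by linarith
      omega) hq0 hq (u := N / 5) (by positivity) (by linarith)
  refine (measureReal_mono (Set.ofPred_subset_ofPred.2 fun G hG => ?_)
    (measure_ne_top _ _)).trans (hmain.trans ?_)
  -- Half of m * s * d is at least 0.247 / 16 times tN, and 0.247 / 16 > 1/75.
  · have h2 : 0.247 * (N : ℝ) ≤ m * s := by
      calc 0.247 * (N : ℝ) ≤ (0.499 * (N / n)) * (0.495 * n) := by
            field_simp; norm_num
        _ ≤ m * s := by gcongr
    have h3 : 0.247 * (N : ℝ) * (t / 8) ≤ m * s * d := by gcongr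
    have h4 : 0 ≤ t * N := by positivity
    linarith
  · calc (2 : ℝ) ^ (m + r) * Real.exp (-(q * (m / 2 * (N / 5))))
        ≤ Real.exp 1 ^ N * Real.exp (-(3.4 * N)) := by
          refine mul_le_mul ?_ (Real.exp_le_exp.2 (neg_le_neg ?_)) (by positivity) (by positivity)
          · calc (2 : ℝ) ^ (m + r) ≤ Real.exp 1 ^ (m + r) := by
                  gcongr; linarith [Real.exp_one_gt_d9]
              _ ≤ Real.exp 1 ^ N :=
                  pow_le_pow_right₀ (by linarith [Real.exp_one_gt_d9]) hmr
          -- Here qm ≥ 34 yields the exponent 3.4N, which beats the at most e^N choices of sets.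
          · have h1 : q * (m / 2 * (N / 5)) = q * m * (N / 10) := by ring
            rw [h1]
            nlinarith
      _ = Real.exp (N + -(3.4 * N)) := by
          rw [Real.exp_add, ← Real.exp_nat_mul, mul_one]
      _ ≤ Real.exp (-n) := by
          gcongr
          linarith

/-- With t = L / log ω > 10 and d = ⌈t/8⌉ ≤ 0.225t, the goodness probability is at least ω^(-d) ≥
(N/n)^(-0.225), so its product with the number of cells is large. The bound N ≤ n e^(2n) gives L ≤
2n, hence 2d ≤ n, so the groups are nonempty. -/
lemma measureReal_exIn_lt_le_exp_of_large_log (hn : 100 ≤ n) (hN : 3 * (n : ℝ) ≤ N)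
    (hN2 : (N : ℝ) ≤ n * Real.exp (2 * n)) {ω : ℝ} (hω : 6 ≤ ω)
    (hL : Real.log ((N : ℝ) / n) = ω * (n * p))
    (hLω : 10 * Real.log ω < Real.log ((N : ℝ) / n)) : (binomialRandom (Fin N) p).real
      {G | (G.exIn (pathGraph (n + 1)) : ℝ) < 1 / 75 * (ω / Real.log ω) * ((p : ℝ) * n * N)} ≤
      Real.exp (-n) := by
  have hn100 : (100 : ℝ) ≤ n := by exact_mod_cast hn
  have hn' : (0 : ℝ) < n := by linarith
  have hN' : (0 : ℝ) < N := by linarith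
  have hp0 : (0 : ℝ) ≤ p := p.2.1
  set L := Real.log ((N : ℝ) / n) with hLdef
  set x := Real.log ω with hxdef
  have hexpL : Real.exp L = N / n := Real.exp_log (by positivity)
  have hx : 1.38 ≤ x := by
    have h4 : Real.log 4 = 2 * Real.log 2 := by
      rw [show (4 : ℝ) = 2 ^ 2 by norm_num, Real.log_pow]; norm_num
    have : Real.log 4 ≤ x := Real.log_le_log (by norm_num) (by linarith)
    linarith [Real.log_two_gt_d9]
  have hx0 : 0 < x := by linarith
  have hL2 : L ≤ 2 * n := by
    rw [hLdef, Real.log_le_iff_le_exp (by positivity), div_le_iff₀ hn']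
    linarith
  have hL10 : 10 ≤ L := by linarith
  set t := L / x with ht
  have htx : t * x = L := by rw [ht]; field_simp
  have ht10 : 10 ≤ t := by rw [ht, le_div_iff₀ hx0]; linarith
  set d := ⌈t / 8⌉₊
  have hd1 : t / 8 ≤ d := Nat.le_ceil _
  have hd2 : (d : ℝ) ≤ 0.225 * t := by
    have := Nat.ceil_lt_add_one (show 0 ≤ t / 8 by linarith)
    linarith
  have hd0 : 0 < d := Nat.ceil_pos.2 (by linarith)
  have hd0' : (0 : ℝ) < d := by exact_mod_cast hd0
  have hdx : d * x ≤ 0.225 * L := by rw [← htx]; nlinarith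
  have h2d : 2 * d ≤ n := by
    have : 2 * (d : ℝ) ≤ n := by nlinarith
    exact_mod_cast this
  set k := n / (2 * d)
  have hk1 : 1 ≤ k := (Nat.one_le_div_iff (by omega)).2 h2d
  have hdk : 2 * d * k ≤ n := Nat.mul_div_le _ _
  have hnk : (n : ℝ) ≤ 4 * d * k := by
    have h1 : n < 2 * d * (k + 1) := by
      have := Nat.lt_mul_div_succ n (show 0 < 2 * d by omega)
      simpa [k] using this
    have h2 : 2 * d * (k + 1) ≤ 2 * d * (2 * k) := Nat.mul_le_mul_left _ (by omega)
    have h3 : n ≤ 4 * d * k := by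
      calc n ≤ 2 * d * (2 * k) := by omega
        _ = 4 * d * k := by ring
    exact_mod_cast h3
  have hhit : 1 / ω ≤ 1 - (1 - p : ℝ) ^ k := by
    refine le_trans ?_ (div_one_add_le_one_sub_pow p.2.1 p.2.2 k)
    have hy : 0 ≤ (k : ℝ) * p := by positivity
    have h1 : L ≤ 4 * d * (ω * (k * p)) := by
      rw [hL]
      have : ω * p * n ≤ ω * p * (4 * d * k) := by gcongr
      linarith
    -- Otherwise L < 6d, whereas d log ω ≤ 0.225L and log ω ≥ 1.38 give 6d < L.
    have h2 : 1.5 ≤ ω * (k * p) := by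
      by_contra! hlt
      have h3 : 4 * d * (ω * (k * p)) < 4 * d * 1.5 := by gcongr
      have h4 : (d : ℝ) * 1.38 ≤ d * x := by gcongr
      linarith
    rw [div_le_div_iff₀ (by linarith) (by linarith)]
    nlinarith
  set q := (1 / ω) ^ d with hq
  have hqexp : q = Real.exp (-(d * x)) := by
    have hωx : ω = Real.exp x := (Real.exp_log (by linarith)).symm
    rw [hq, one_div, hωx, ← Real.exp_neg, ← Real.exp_nat_mul]
    ring_nf
  have hexp1 : (2.7 : ℝ) ≤ Real.exp 1 := by linarith [Real.exp_one_gt_d9]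
  have hNn : 1000 ≤ (N : ℝ) / n := by
    rw [← hexpL]
    calc (1000 : ℝ) ≤ 2.7 ^ 10 := by norm_num
      _ ≤ Real.exp 1 ^ 10 := by gcongr
      _ = Real.exp 10 := by rw [← Real.exp_nat_mul]; norm_num
      _ ≤ Real.exp L := by gcongr
  have hNn' : 1000 * (n : ℝ) ≤ N := by rwa [le_div_iff₀ hn'] at hNn
  have hqm : 34 ≤ q * (N / (2 * n) : ℕ) := by
    calc (34 : ℝ) ≤ 2.7 ^ 7 * 0.499 := by norm_num
      _ ≤ Real.exp 1 ^ 7 * 0.499 := by gcongr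
      _ = Real.exp 7 * 0.499 := by rw [← Real.exp_nat_mul]; norm_num
      _ ≤ Real.exp (-(d * x) + L) * 0.499 := by
          gcongr
          linarith
      _ = q * (0.499 * ((N : ℝ) / n)) := by rw [hqexp, ← hexpL, Real.exp_add]; ring
      _ ≤ q * (N / (2 * n) : ℕ) := by
          gcongr
          exact mul_le_cast_div_two_mul (by omega) hNn'
  have h1 : ω / x * (p * n * N) = t * N := by
    rw [ht, hL]; ring
  rw [mul_assoc, h1]
  exact measureReal_exIn_lt_le_exp_of_cells hn hNn' hdk (by positivity)
    (pow_le_pow_left₀ (by positivity) hhit d) hqm (by linarith) hd1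

lemma exp_neg_le_inv (hn : 0 < n) : Real.exp (-n) ≤ 1 / n := by
  have hn' : (0 : ℝ) < n := by exact_mod_cast hn
  rw [Real.exp_neg, ← one_div]
  gcongr
  linarith [Real.add_one_le_exp (n : ℝ)]

/-- Lower tail bound in the sparse range. -/
lemma measureReal_exIn_lt_le_of_sparse (hn : 100 ≤ n) (hN : 3 * (n : ℝ) ≤ N)
    (hN2 : (N : ℝ) ≤ n * Real.exp (2 * n)) {ω : ℝ} (hω : 6 ≤ ω)
    (hL : Real.log ((N : ℝ) / n) = ω * (n * p)) (hp : (N : ℝ)⁻¹ ≤ p) :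
    (binomialRandom (Fin N) p).real
      {G | (G.exIn (pathGraph (n + 1)) : ℝ) < 1 / 75 * (ω / Real.log ω) * ((p : ℝ) * n * N)} ≤
      1000 / n := by
  have hn' : (0 : ℝ) < n := by exact_mod_cast (by omega : 0 < n)
  rcases lt_or_ge (10 * Real.log ω) (Real.log ((N : ℝ) / n)) with h | h
  · refine (measureReal_exIn_lt_le_exp_of_large_log hn hN hN2 hω hL h).trans
      ((exp_neg_le_inv (by omega)).trans ?_)
    gcongr
    norm_num
  · refine (measureReal_mono (Set.ofPred_subset_ofPred.2 fun G hG => lt_of_lt_of_le hG ?_)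
      (measure_ne_top _ _)).trans (measureReal_exIn_lt_le_of_inv_le hn hN hp)
    have hx0 : 0 < Real.log ω := Real.log_pos (by linarith)
    have h1 : ω / Real.log ω * (p * n * N) = Real.log ((N : ℝ) / n) / Real.log ω * N := by
      rw [hL]; ring
    have h2 : Real.log ((N : ℝ) / n) / Real.log ω ≤ 10 := by
      rw [div_le_iff₀ hx0]; exact h
    rw [mul_assoc, h1]
    nlinarith [mul_le_mul_of_nonneg_right h2 (Nat.cast_nonneg (α := ℝ) N)]

/-! ### Combining the two tails -/

lemma one_sub_le_probExPath {k : ℕ} {a b ε δ : ℝ}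
    (ha : (binomialRandom (Fin N) p).real {G | (G.exIn (pathGraph k) : ℝ) < a} ≤ ε)
    (hb : (binomialRandom (Fin N) p).real {G | b < (G.exIn (pathGraph k) : ℝ)} ≤ δ) :
    1 - (ε + δ) ≤ probExPath N p k a b := by
  have h : (Set.univ : Set (SimpleGraph (Fin N))) ⊆
      {G | a ≤ (G.exIn (pathGraph k) : ℝ) ∧ (G.exIn (pathGraph k) : ℝ) ≤ b} ∪
      ({G | (G.exIn (pathGraph k) : ℝ) < a} ∪ {G | b < (G.exIn (pathGraph k) : ℝ)}) := by
    intro G _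
    simp only [Set.mem_union, Set.mem_ofPred_eq]
    by_cases h1 : a ≤ (G.exIn (pathGraph k) : ℝ)
    · by_cases h2 : (G.exIn (pathGraph k) : ℝ) ≤ b
      · exact .inl ⟨h1, h2⟩
      · exact .inr (.inr (not_le.1 h2))
    · exact .inr (.inl (not_le.1 h1))
  have h1 := measureReal_mono (μ := binomialRandom (Fin N) p) h (measure_ne_top _ _)
  rw [probReal_univ] at h1
  have h2 := measureReal_union_le (μ := binomialRandom (Fin N) p)
    {G | a ≤ (G.exIn (pathGraph k) : ℝ) ∧ (G.exIn (pathGraph k) : ℝ) ≤ b}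
    ({G | (G.exIn (pathGraph k) : ℝ) < a} ∪ {G | b < (G.exIn (pathGraph k) : ℝ)})
  have h3 := measureReal_union_le (μ := binomialRandom (Fin N) p)
    {G | (G.exIn (pathGraph k) : ℝ) < a} {G | b < (G.exIn (pathGraph k) : ℝ)}
  rw [probExPath]
  linarith

lemma tendsto_probExPath {N : ℕ → ℕ} {p : ℕ → I} {a b : ℕ → ℝ}
    (h : ∀ᶠ n : ℕ in atTop,
      (binomialRandom (Fin (N n)) (p n)).real
        {G | (G.exIn (pathGraph (n + 1)) : ℝ) < a n} ≤ 1000 / n ∧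
      (binomialRandom (Fin (N n)) (p n)).real
        {G | b n < (G.exIn (pathGraph (n + 1)) : ℝ)} ≤ Real.exp (-n)) :
    Tendsto (fun n : ℕ ↦ probExPath (N n) (p n) (n + 1) (a n) (b n)) atTop (𝓝 1) := by
  have h1 : Tendsto (fun n : ℕ => 1 - (1000 / (n : ℝ) + Real.exp (-n))) atTop (𝓝 1) := by
    have h2 : Tendsto (fun n : ℕ => Real.exp (-(n : ℝ))) atTop (𝓝 0) :=
      Real.tendsto_exp_neg_atTop_nhds_zero.comp tendsto_natCast_atTop_atTop
    simpa using ((tendsto_const_div_atTop_nhds_zero_nat (1000 : ℝ)).add h2).const_sub 1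
  refine tendsto_of_tendsto_of_tendsto_of_le_of_le' h1 tendsto_const_nhds ?_ ?_
  · filter_upwards [h] with n hn
    exact one_sub_le_probExPath hn.1 hn.2
  · exact .of_forall fun n => measureReal_le_one

end Estimates

end SimpleGraph

theorem theorem1p4 (N : ℕ → ℕ)
    (hN : ∀ᶠ n : ℕ in atTop, 3 * (n : ℝ) ≤ N n ∧ (N n : ℝ) ≤ n * Real.exp (2 * n)) :
    (∀ p : ℕ → unitInterval,
      (∀ᶠ n : ℕ in atTop, Real.log ((N n : ℝ) / n) / (6 * n) ≤ (p n : ℝ)) →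
      Tendsto
        (fun n : ℕ ↦ SimpleGraph.probExPath (N n) (p n) (n + 1)
          (1 / 4 * ((p n : ℝ) * n * N n))
          (18 * ((p n : ℝ) * n * N n)))
        atTop (𝓝 1)) ∧
    (∀ (p : ℕ → unitInterval) (ω : ℕ → ℝ),
      (∀ n : ℕ, ω n = Real.log ((N n : ℝ) / n) / (n * (p n : ℝ))) →
      (∀ᶠ n : ℕ in atTop, (N n : ℝ)⁻¹ ≤ (p n : ℝ) ∧
        (p n : ℝ) ≤ Real.log ((N n : ℝ) / n) / (6 * n)) →
      Tendsto
        (fun n : ℕ ↦ SimpleGraph.probExPath (N n) (p n) (n + 1)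
          (1 / 75 * (ω n / Real.log (ω n)) * ((p n : ℝ) * n * N n))
          (8 * (ω n / Real.log (ω n)) * ((p n : ℝ) * n * N n)))
        atTop (𝓝 1)) := by
  refine ⟨fun p hp => SimpleGraph.tendsto_probExPath ?_,
    fun p ω hω hp => SimpleGraph.tendsto_probExPath ?_⟩
  · filter_upwards [hN, hp, eventually_ge_atTop 100] with n hNn hpn hn
    exact ⟨SimpleGraph.measureReal_exIn_lt_le_of_dense hn hNn.1 hpn,
      SimpleGraph.measureReal_lt_exIn_le_exp_of_dense (by omega) hNn.1 hpn⟩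
  · filter_upwards [hN, hp, eventually_ge_atTop 100] with n hNn hpn hn
    have hn' : (0 : ℝ) < n := by exact_mod_cast (by omega : 0 < n)
    have hN' : (0 : ℝ) < N n := by linarith [hNn.1]
    have hp0 : (0 : ℝ) < p n := lt_of_lt_of_le (inv_pos.2 hN') hpn.1
    have hL : Real.log ((N n : ℝ) / n) = ω n * (n * p n) := by
      rw [hω n, div_mul_cancel₀ _ (by positivity)]
    have hω6 : 6 ≤ ω n := by
      rw [hω n, le_div_iff₀ (by positivity)]
      have := (le_div_iff₀ (by positivity)).1 hpn.2
      linarith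
    exact ⟨SimpleGraph.measureReal_exIn_lt_le_of_sparse hn hNn.1 hNn.2 hω6 hL hpn.1,
      SimpleGraph.measureReal_lt_exIn_le_exp_of_sparse (by omega) hNn.1 hω6 hL⟩
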